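/- Let $a\in\mathbb C$ with $\operatorname{Re}(a)>0$, let $0=\eta_0<\eta_1<\dots<\eta_m=1$, and let $b_{kj}^r\in\mathbb C$ for $k,j\in\{0,1\}$, $r\in\{0,\dots,m\}$. For $\lambda\in\mathbb C\setminus\{0\}$ put $E_r(\lambda)=e^{-i\lambda\eta_r}$, $$B_{0k}^r(\lambda)=\tfrac12E_r(-\lambda)\Big[\frac{b_{0k}^r}{i\lambda}+b_{1k}^r\Big],\qquad B_{1k}^r(\lambda)=\tfrac12E_r(\lambda)\Big[-\frac{b_{0k}^r}{i\lambda}+b_{1k}^r\Big],$$ and let $\mathcal A(\lambda)$ be the $2(m+1)\times2(m+1)$ matrix for which $$(x_0,X_0,\dots,x_m,X_m)\,\mathcal A=(h_0,h_1,y_1,Y_1,\dots,y_m,Y_m)$$ means $\sum_{r=0}^m(x_rB_{0k}^r+X_rB_{1k}^r)=h_k$ for $k=0,1$ and $x_r-x_{r-1}=y_r$, $X_r-X_{r-1}=Y_r$ for $r=1,\dots,m$. Assume that $\Delta=\det\mathcal A$ is not identically zero on $\mathbb C\setminus\{0\}$. For $R>0$ let $D_R^\pm=\{\lambda:|\lambda|>R,\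 \operatorname{Re}(a\lambda^2)<0,\ \pm\operatorname{Im}\lambda>0\}$, with $\partial D_R^\pm$ oriented so that $D_R^\pm$ lies to the left. Then there is $R_0>0$, depending only on $a$, the $\eta_r$ and the $b_{kj}^r$, such that the following holds for all $R\ge R_0$. Let $q$ be a solution on $[0,1]\times[0,T]$, with $q,q_x,q_{xx}$ continuous up to the boundary, of $q_t=a\,q_{xx}$ in $(0,1)\times(0,T)$, $q(\cdot,0)=q_0$ on $[0,1]$, and $\sum_{k=0}^1\sum_{r=0}^m b_{kj}^r\partial_x^kq(\eta_r,t)=g_j(t)$ for $t\in[0,T]$, $j=0,1$. For a function $u$ on $[0,1]$ write $\hat u^r(\lambda)=\int_{\eta_{r-1}}^{\eta_r}e^{-i\lambda x}u(x)\,dx$, and let $\hat q_0^r$, $\hat q_\tau^r$ be these transforms of $q_0$ and of $q(\cdot,\tau)$. Let $t\in(0,T)$ and $\tau\in[t,T]$, and let $(x_0,X_0,\dots,x_m,X_m)$ be the solution of the system with $h_0=h_1=0$, $y_r=\hat q_\tau^r(\lambda)$, $Y_r=\hat q_\tau^r(-\lambda)$. Suppose that $$x_0(\lambda)=\mathcal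 O(\lambda^{-1})\ \text{ as }\lambda\to\infty\text{ in }\overline{D_R^+},\qquad x_m(\lambda)=\mathcal O(E_m(\lambda)\lambda^{-1})\ \text{ as }\lambda\to\infty\text{ in }\overline{D_R^-}.$$ Then for every $x\in(0,1)$ the following contour integrals converge absolutely and vanish: $$\int_{\partial D_R^+}e^{i\lambda x+a\lambda^2(\tau-t)}x_0(\lambda)\,d\lambda=0,\qquad\int_{\partial D_R^-}e^{i\lambda x+a\lambda^2(\tau-t)}x_m(\lambda)\,d\lambda=0.$$ Consequently the terms involving the unknown $\hat q_\tau^r$ do not contribute to the solution representation, in the following sense. Put $$f_0^r(\lambda)=ia\lambda\int_0^\tau e^{a\lambda^2s}q(\eta_r,s)\,ds,\qquad f_1^r(\lambda)=a\int_0^\tau e^{a\lambda^2s}q_x(\eta_r,s)\,ds,$$ and let $(\xi_0,\Xi_0,\dots,\xi_m,\Xi_m)$ be the solution of the system with only known data, $h_j=a\int_0^\tau e^{a\lambda^2s}g_j(s)\,ds$, $y_r=-\hat q_0^r(\lambda)$, $Y_r=-\hat q_0^r(-\lambda)$. Then $f_0^0+f_1^0=\xi_0+e^{a\lambda^2\tau}x_0$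 on $\partial D_R^+$ and $E_m(f_0^m+f_1^m)=\xi_m+e^{a\lambda^2\tau}x_m$ on $\partial D_R^-$, the last two integrals below converge absolutely when $u=\xi_0$, $v=\xi_m$, and the representation $$\int_{\mathbb R}e^{i\lambda x-a\lambda^2t}\int_0^1e^{-i\lambda y}q_0(y)\,dy\,d\lambda-\int_{\partial D_R^+}e^{i\lambda x-a\lambda^2t}u(\lambda)\,d\lambda-\int_{\partial D_R^-}e^{i\lambda x-a\lambda^2t}v(\lambda)\,d\lambda$$ has the same value for $u=f_0^0+f_1^0$, $v=E_m(f_0^m+f_1^m)$ as for $u=\xi_0$, $v=\xi_m$. -/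

import Mathlib

open Set

namespace Multipoint

noncomputable section

/-! In this file `a` is the coefficient of the second order equation `q_t + a (-i ∂_x)² q = 0`,
`η : Fin (m+1) → ℝ` lists the points `0 = η₀ < η₁ < ⋯ < η_m = 1`, and `b k j r` is the coefficient
of `∂_x^k q(η_r, t)` in the multipoint condition number `j`. The spectral variable is `z`. -/

/-- The `k`-th partial derivative `∂_x^k q(x,t)` on `[0,1]` (one-sided at the end points). -/
def dx (q : ℝ → ℝ → ℂ) (k : ℕ) (x t : ℝ) : ℂ :=
  iteratedDerivWithin k (fun y => q y t) (Icc 0 1) x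

/-- `q` is a classical solution of the initial-multipoint value problem of order two:
`q_t + a (-i ∂_x)² q = 0` on `(0,1) × (0,T)`, `q(x,0) = q₀(x)` on `[0,1]`, and
`∑_k ∑_r b k j r ∂_x^k q(η_r,t) = g_j(t)` on `[0,T]`; the function and its `x`-derivatives up to
order two are continuous up to the boundary. -/
structure IsSolution {m : ℕ} (a : ℂ) (η : Fin (m + 1) → ℝ) (b : Fin 2 → Fin 2 → Fin (m + 1) → ℂ)
    (T : ℝ) (q₀ : ℝ → ℂ) (g : Fin 2 → ℝ → ℂ) (q : ℝ → ℝ → ℂ) : Prop where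
  contDiffOn : ∀ t ∈ Icc 0 T, ContDiffOn ℝ 2 (fun x => q x t) (Icc 0 1)
  continuousOn : ∀ k ≤ 2, ContinuousOn (fun p : ℝ × ℝ => dx q k p.1 p.2) (Icc 0 1 ×ˢ Icc 0 T)
  pde : ∀ x ∈ Ioo (0 : ℝ) 1, ∀ t ∈ Ioo 0 T,
    HasDerivAt (fun s => q x s) (-(a * ((-Complex.I) ^ 2 * dx q 2 x t))) t
  initial : ∀ x ∈ Icc (0 : ℝ) 1, q x 0 = q₀ x
  multipoint : ∀ j : Fin 2, ∀ t ∈ Icc 0 T,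
    ∑ k : Fin 2, ∑ r : Fin (m + 1), b k j r * dx q k (η r) t = g j t

/-- `E_r(z) = exp(-i z η_r)`. -/
def E {m : ℕ} (η : Fin (m + 1) → ℝ) (r : Fin (m + 1)) (z : ℂ) : ℂ :=
  Complex.exp (-Complex.I * z * η r)

/-- The Fourier transform of `u` over the subinterval number `r + 1`, that is over
`[η_r, η_{r+1}]`, where `r = 0, …, m - 1`. -/
def pieceHat {m : ℕ} (η : Fin (m + 1) → ℝ) (u : ℝ → ℂ) (r : Fin m) (z : ℂ) : ℂ :=
  ∫ x in (η r.castSucc)..(η r.succ), Complex.exp (-Complex.I * z * x) * u x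

/-- The entries `B_{p k}^r(z)`, `p, k ∈ {0,1}`, of the first two columns of the matrix. -/
def B {m : ℕ} (η : Fin (m + 1) → ℝ) (b : Fin 2 → Fin 2 → Fin (m + 1) → ℂ)
    (p k : Fin 2) (r : Fin (m + 1)) (z : ℂ) : ℂ :=
  if p = 0 then 1 / 2 * E η r (-z) * (b 0 k r * (1 / (Complex.I * z)) + b 1 k r)
  else 1 / 2 * E η r z * (-(b 0 k r * (1 / (Complex.I * z))) + b 1 k r)

/-- The `2(m+1) × 2(m+1)` matrix `𝒜(z)`. A row is indexed by `(j, p)`, where `p = 0` stands for the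
unknown `x_j` and `p = 1` for `X_j`. The column `(0, k)` carries the multipoint condition number
`k`; for `r = 0, …, m - 1` the columns `(r + 1, 0)` and `(r + 1, 1)` encode
`x_{r+1} - x_r` and `X_{r+1} - X_r`. -/
def matA {m : ℕ} (η : Fin (m + 1) → ℝ) (b : Fin 2 → Fin 2 → Fin (m + 1) → ℂ) (z : ℂ) :
    Matrix (Fin (m + 1) × Fin 2) (Fin (m + 1) × Fin 2) ℂ :=
  Matrix.of fun row col =>
    Fin.cases (motive := fun _ => ℂ)
      (B η b row.2 col.2 row.1 z)
      (fun r => if row.2 = col.2 then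
          (if row.1 = r.succ then 1 else if row.1 = r.castSucc then -1 else 0)
        else 0)
      col.1

/-- The determinant `Δ(z)` of the system. -/
def Delta {m : ℕ} (η : Fin (m + 1) → ℝ) (b : Fin 2 → Fin 2 → Fin (m + 1) → ℂ) (z : ℂ) : ℂ :=
  (matA η b z).det

/-- The row vector `(h₀, h₁, y₁, Y₁, …, y_m, Y_m)`. -/
def rowVec {m : ℕ} (h : Fin 2 → ℂ) (y Y : Fin m → ℂ) : Fin (m + 1) × Fin 2 → ℂ := fun col =>
  Fin.cases (motive := fun _ => ℂ) (h col.2) (fun r => if col.2 = 0 then y r else Y r) col.1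

/-- The solution `(x₀, X₀, …, x_m, X_m)` of `(x₀, X₀, …, x_m, X_m) 𝒜(z) = v`, at the points `z`
where `Δ(z) ≠ 0` (see `sysSol_eq_iff`). -/
def sysSol {m : ℕ} (η : Fin (m + 1) → ℝ) (b : Fin 2 → Fin 2 → Fin (m + 1) → ℂ) (z : ℂ)
    (v : Fin (m + 1) × Fin 2 → ℂ) : Fin (m + 1) × Fin 2 → ℂ :=
  Matrix.vecMul v (matA η b z)⁻¹

theorem sysSol_eq_iff {m : ℕ} (η : Fin (m + 1) → ℝ) (b : Fin 2 → Fin 2 → Fin (m + 1) → ℂ) (z : ℂ)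
    (hz : Delta η b z ≠ 0) (v X : Fin (m + 1) × Fin 2 → ℂ) :
    sysSol η b z v = X ↔ Matrix.vecMul X (matA η b z) = v := by
  have hu : IsUnit (matA η b z).det := isUnit_iff_ne_zero.mpr hz
  constructor
  · rintro rfl
    simp [sysSol, Matrix.vecMul_vecMul, Matrix.nonsing_inv_mul _ hu]
  · rintro rfl
    simp [sysSol, Matrix.vecMul_vecMul, Matrix.mul_nonsing_inv _ hu]

/-- The component `x_r(z)`, as a function of `z`, of the solution of the system with right-hand side
`(0, 0, q̂_τ^1(z), q̂_τ^1(-z), …, q̂_τ^m(z), q̂_τ^m(-z))`, where `q̂_τ^r` are the transforms of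
`q(·, τ)` over the subintervals. -/
def xTau {m : ℕ} (η : Fin (m + 1) → ℝ) (b : Fin 2 → Fin 2 → Fin (m + 1) → ℂ)
    (q : ℝ → ℝ → ℂ) (τ : ℝ) (r : Fin (m + 1)) (z : ℂ) : ℂ :=
  sysSol η b z (rowVec 0 (fun l => pieceHat η (fun x => q x τ) l z)
    (fun l => pieceHat η (fun x => q x τ) l (-z))) (r, 0)

/-- The transform `h_j(z;τ) = a / (-i²) ∫₀^τ e^{a z² s} g_j(s) ds` of the boundary data. -/
def hData (a : ℂ) (g : Fin 2 → ℝ → ℂ) (τ : ℝ) (z : ℂ) (j : Fin 2) : ℂ :=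
  a / (-(Complex.I ^ 2)) * ∫ s in (0 : ℝ)..τ, Complex.exp (a * z ^ 2 * s) * g j s

/-- The component `x_r(z)` of the solution of the system with only known data on the right:
`(h₀(z;τ), h₁(z;τ), -q̂₀^1(z), -q̂₀^1(-z), …, -q̂₀^m(z), -q̂₀^m(-z))`. -/
def xData {m : ℕ} (a : ℂ) (η : Fin (m + 1) → ℝ) (b : Fin 2 → Fin 2 → Fin (m + 1) → ℂ)
    (q₀ : ℝ → ℂ) (g : Fin 2 → ℝ → ℂ) (τ : ℝ) (r : Fin (m + 1)) (z : ℂ) : ℂ :=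
  sysSol η b z (rowVec (hData a g τ z) (fun l => -pieceHat η q₀ l z)
    (fun l => -pieceHat η q₀ l (-z))) (r, 0)

/-- The coefficients `c₀(z) = i a z`, `c₁(z) = a`, for which the equation takes the divergence form
`(e^{-izx + az²t} q)_t = (e^{-izx + az²t} (c₀ q + c₁ q_x))_x`. -/
def c (a z : ℂ) (k : Fin 2) : ℂ := if k = 0 then Complex.I * a * z else a

/-- The boundary transforms `f_k^r(z;τ) = c_k(z) ∫₀^τ e^{a z² s} ∂_x^k q(η_r, s) ds`. -/
def f {m : ℕ} (a : ℂ) (η : Fin (m + 1) → ℝ) (q : ℝ → ℝ → ℂ) (τ : ℝ) (k : Fin 2)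
    (r : Fin (m + 1)) (z : ℂ) : ℂ :=
  c a z k * ∫ s in (0 : ℝ)..τ, Complex.exp (a * z ^ 2 * s) * dx q k (η r) s

/-- `D_R^+ = {|z| > R, Re (a z²) < 0, Im z > 0}`. -/
def Dplus (a : ℂ) (R : ℝ) : Set ℂ := {z | R < ‖z‖ ∧ (a * z ^ 2).re < 0 ∧ 0 < z.im}

/-- `D_R^- = {|z| > R, Re (a z²) < 0, Im z < 0}`. -/
def Dminus (a : ℂ) (R : ℝ) : Set ℂ := {z | R < ‖z‖ ∧ (a * z ^ 2).re < 0 ∧ z.im < 0}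

/-- The point `r e^{iφ}`. -/
def polar (r φ : ℝ) : ℂ := r * Complex.exp (φ * Complex.I)

/-- The integral of `F` along the boundary of `{r e^{iφ} : r > R, φ₁ < φ < φ₂}`, oriented so that
this region lies to the left: inwards along the ray of angle `φ₂`, along the arc of radius `R` from
`φ₂` to `φ₁`, and outwards along the ray of angle `φ₁`. -/
def sectorIntegral (φ₁ φ₂ R : ℝ) (F : ℂ → ℂ) : ℂ :=
  -(∫ r in Ioi R, F (polar r φ₂) * Complex.exp (φ₂ * Complex.I))
    + (∫ φ in φ₂..φ₁, F (polar R φ) * (Complex.I * polar R φ))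
    + ∫ r in Ioi R, F (polar r φ₁) * Complex.exp (φ₁ * Complex.I)

/-- The integral along the boundary of the sector is absolutely convergent. -/
def SectorIntegrable (φ₁ φ₂ R : ℝ) (F : ℂ → ℂ) : Prop :=
  MeasureTheory.IntegrableOn (fun r : ℝ => F (polar r φ₂)) (Ioi R) ∧
  IntervalIntegrable (fun φ : ℝ => F (polar R φ)) MeasureTheory.volume φ₂ φ₁ ∧
  MeasureTheory.IntegrableOn (fun r : ℝ => F (polar r φ₁)) (Ioi R)

/-- For `Re a > 0`, the set `D_R^+` is the part `|z| > R` of the sector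
`angle a < arg z < angle a + π/2`, which lies in the upper half plane, and `D_R^- = -D_R^+`. -/
def angle (a : ℂ) : ℝ := Real.pi / 4 - a.arg / 2

/-- `∫_{∂D_R^+} F(z) dz`, for `Re a > 0`. -/
def intPlus (a : ℂ) (R : ℝ) (F : ℂ → ℂ) : ℂ :=
  sectorIntegral (angle a) (angle a + Real.pi / 2) R F

/-- `∫_{∂D_R^-} F(z) dz`, for `Re a > 0`. -/
def intMinus (a : ℂ) (R : ℝ) (F : ℂ → ℂ) : ℂ :=
  sectorIntegral (angle a + Real.pi) (angle a + Real.pi / 2 + Real.pi) R F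

/-- Absolute convergence of `∫_{∂D_R^+} F(z) dz`. -/
def IntegrablePlus (a : ℂ) (R : ℝ) (F : ℂ → ℂ) : Prop :=
  SectorIntegrable (angle a) (angle a + Real.pi / 2) R F

/-- Absolute convergence of `∫_{∂D_R^-} F(z) dz`. -/
def IntegrableMinus (a : ℂ) (R : ℝ) (F : ℂ → ℂ) : Prop :=
  SectorIntegrable (angle a + Real.pi) (angle a + Real.pi / 2 + Real.pi) R F

/-- The factor `e^{izx - az²t}` of the solution representation. -/
def kern (a : ℂ) (x t : ℝ) (z : ℂ) : ℂ := Complex.exp (Complex.I * z * x - a * z ^ 2 * t)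

/-- The right-hand side of the representation of `2π q(x,t)`,
`∫_ℝ e^{izx-az²t} q̂₀(z) dz - ∫_{∂D_R^+} e^{izx-az²t} u(z) dz - ∫_{∂D_R^-} e^{izx-az²t} v(z) dz`;
the representation has `u = f_0^0 + f_1^0` and `v = e^{-iz} (f_0^m + f_1^m)`. -/
def representation (a : ℂ) (q₀ : ℝ → ℂ) (R x t : ℝ) (u v : ℂ → ℂ) : ℂ :=
  (∫ z : ℝ, kern a x t z * ∫ y in (0 : ℝ)..1, Complex.exp (-Complex.I * z * y) * q₀ y)
    - intPlus a R (fun z => kern a x t z * u z)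
    - intMinus a R (fun z => kern a x t z * v z)

end

end Multipoint

namespace Multipoint

section

open Filter Topology Asymptotics MeasureTheory Bornology

/-! Vanishing of the integrals. Expanding the determinant shows that `Δ` is a finite sum of terms `c
e^{-iωz} z^{-k}`. Since `Re a > 0`, the form `Re (a z²)` is positive on the real axis away from `0`,
so the closures of `D_R^±` lie in a cone `c‖z‖ ≤ |Im z|`. In the upper or lower half of such a cone
one monomial dominates all others, hence `Δ` has no zeros there once `‖z‖` is large
(`exists_Delta_ne_zero`); this fixes `R₀`. There the solution of the system is holomorphic by
Cramer's rule. Moreover `|e^{izx} E_r(z)| = e^{(η_r - x) Im z}` decays exponentially for `r = 0` in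
the upper half and for `r = m` in the lower half, while `e^{az²(τ-t)}` is bounded. With the assumed
bounds on `x₀` and `x_m`, Cauchy's theorem closes the contour at infinity
(`sectorIntegral_eq_zero`).

Representation. Integrating the divergence form of the equation over `[η_{r-1}, η_r] × [0, τ]` gives
a global relation between the transforms at adjacent points. These relations at `z` and `-z`,
together with the transformed multipoint conditions, say that the vector of all `E_r(±z)(f_0^r +
f_1^r)(±z)` solves the linear system. Uniqueness and linearity split it into the part from the data
plus `e^{az²τ}` times the part from `q(·, τ)` (`boundary_split`). Multiplied by `e^{izx - az²t}`,
the second part is exactly an integrand already shown to integrate to zero. The data integral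
converges because it is a difference of two convergent ones (`sector_contribution`). -/

/-! ### Contour integrals along the boundary of a sector, and Cauchy's theorem -/

theorem norm_polar {r : ℝ} (hr : 0 ≤ r) (φ : ℝ) : ‖polar r φ‖ = r := by
  simp [polar, Complex.norm_exp, abs_of_nonneg hr]

theorem continuous_polar : Continuous fun p : ℝ × ℝ => polar p.1 p.2 := by
  unfold polar; fun_prop

theorem polar_im (r φ : ℝ) : (polar r φ).im = r * Real.sin φ := by
  simp [polar, Complex.exp_ofReal_mul_I_im]

theorem polar_exp (x φ : ℝ) : polar (Real.exp x) φ = Complex.exp (x + φ * Complex.I) := by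
  simp [polar, Complex.exp_add]

/-- An integral along a ray, in logarithmic coordinates. -/
theorem integral_ray_log {R M φ : ℝ} (hR : 0 < R) (hM : R ≤ M) {F : ℂ → ℂ}
    (hF : ∀ r, R ≤ r → ContinuousAt F (polar r φ)) :
    ∫ x in Real.log R..Real.log M,
        F (Complex.exp (x + φ * Complex.I)) * Complex.exp (x + φ * Complex.I) =
      ∫ r in R..M, F (polar r φ) * Complex.exp (φ * Complex.I) := by
  have hM0 : 0 < M := hR.trans_le hM
  have h := intervalIntegral.integral_deriv_smul_comp'' (a := Real.log R) (b := Real.log M)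
    (f := Real.exp) (f' := Real.exp)
    (g := fun r : ℝ => F (polar r φ) * Complex.exp (φ * Complex.I))
    Real.continuous_exp.continuousOn
    (fun x _ => (Real.hasDerivAt_exp x).hasDerivWithinAt) Real.continuous_exp.continuousOn ?_
  · rw [Real.exp_log hR, Real.exp_log hM0] at h
    rw [← h]
    refine intervalIntegral.integral_congr fun x _ => ?_
    simp only [Function.comp, polar_exp, Complex.real_smul, Complex.exp_add, Complex.ofReal_exp]
    ring
  · rintro r ⟨x, hx, rfl⟩
    rw [uIcc_of_le (Real.log_le_log hR hM)] at hx
    have hr : R ≤ Real.exp x := by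
      rw [← Real.exp_log hR]; exact Real.exp_le_exp.2 hx.1
    have h1 : ContinuousAt (fun r : ℝ => polar r φ) (Real.exp x) :=
      (continuous_polar.comp (by fun_prop : Continuous fun r : ℝ => (r, φ))).continuousAt
    exact ((ContinuousAt.comp (f := fun r : ℝ => polar r φ) (hF _ hr) h1).mul
      continuousAt_const).continuousWithinAt

/-- Cauchy's theorem for the boundary of an annular sector. -/
theorem annular_sector_cauchy {φ₁ φ₂ R M : ℝ} (hR : 0 < R) (hM : R ≤ M) (hφ : φ₁ ≤ φ₂) {F : ℂ → ℂ}
    (hd : ∀ r, R ≤ r → ∀ φ ∈ Icc φ₁ φ₂, DifferentiableAt ℂ F (polar r φ)) :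
    -(∫ r in R..M, F (polar r φ₂) * Complex.exp (φ₂ * Complex.I))
      + (∫ φ in φ₂..φ₁, F (polar R φ) * (Complex.I * polar R φ))
      + (∫ r in R..M, F (polar r φ₁) * Complex.exp (φ₁ * Complex.I))
      + ∫ φ in φ₁..φ₂, F (polar M φ) * (Complex.I * polar M φ) = 0 := by
  have hM0 : 0 < M := hR.trans_le hM
  -- The substitution `z = e^w`, `dz = e^w dw`, turns the annular sector into the rectangle `[log R,
  -- log M] × [φ₁, φ₂]`.
  have h := Complex.integral_boundary_rect_eq_zero_of_differentiableOn
    (fun w => F (Complex.exp w) * Complex.exp w)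
    ⟨Real.log R, φ₁⟩ ⟨Real.log M, φ₂⟩ ?_
  · simp only [← intervalIntegral.integral_const_mul, smul_eq_mul] at h
    rw [integral_ray_log hR hM fun r hr => (hd r hr φ₁ ⟨le_rfl, hφ⟩).continuousAt,
      integral_ray_log hR hM fun r hr => (hd r hr φ₂ ⟨hφ, le_rfl⟩).continuousAt] at h
    simp only [← polar_exp, Real.exp_log hR, Real.exp_log hM0] at h
    rw [intervalIntegral.integral_symm φ₁ φ₂]
    have e : ∀ s : ℝ, ∫ φ in φ₁..φ₂, F (polar s φ) * (Complex.I * polar s φ)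
        = ∫ φ in φ₁..φ₂, Complex.I * (F (polar s φ) * polar s φ) := fun s =>
      intervalIntegral.integral_congr fun φ _ => by ring
    rw [e, e]
    linear_combination h
  · intro w hw
    rw [Complex.mem_reProdIm, uIcc_of_le (Real.log_le_log hR hM), uIcc_of_le hφ] at hw
    have hw1 : R ≤ Real.exp w.re := by
      rw [← Real.exp_log hR]; exact Real.exp_le_exp.2 hw.1.1
    have h1 := hd _ hw1 _ hw.2
    rw [polar_exp, Complex.re_add_im] at h1
    exact ((h1.comp w Complex.differentiableAt_exp).mul
      Complex.differentiableAt_exp).differentiableWithinAt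

/-- A function with exponential decay is absolutely integrable along a ray. -/
theorem integrableOn_ray {R φ c : ℝ} {F : ℂ → ℂ} {S : Set ℂ}
    (hS : ∀ r, R ≤ r → polar r φ ∈ S) (hF : ∀ z ∈ S, ContinuousAt F z) (hc : 0 < c)
    (hO : F =O[cobounded ℂ ⊓ 𝓟 S] fun z => Real.exp (-c * ‖z‖)) :
    IntegrableOn (fun r : ℝ => F (polar r φ)) (Ioi R) := by
  have hcont : ContinuousOn (fun r : ℝ => F (polar r φ)) (Ici R) := fun r hr =>
    (ContinuousAt.comp (f := fun r : ℝ => polar r φ) (hF _ (hS r hr))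
      (continuous_polar.comp
        (by fun_prop : Continuous fun r : ℝ => (r, φ))).continuousAt).continuousWithinAt
  have ht : Tendsto (fun r : ℝ => polar r φ) atTop (cobounded ℂ ⊓ 𝓟 S) := by
    refine tendsto_inf.2 ⟨?_, tendsto_principal.2 ?_⟩
    · rw [← tendsto_norm_atTop_iff_cobounded]
      refine tendsto_id.congr' ?_
      filter_upwards [eventually_ge_atTop 0] with r hr
      simp [norm_polar hr]
    · filter_upwards [eventually_ge_atTop R] with r hr using hS r hr
  have h1 : (fun r : ℝ => F (polar r φ)) =O[atTop] fun r => Real.exp (-c * r) := by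
    refine (hO.comp_tendsto ht).congr' EventuallyEq.rfl ?_
    filter_upwards [eventually_ge_atTop 0] with r hr
    simp [norm_polar hr]
  have h2 := integrable_of_isBigO_exp_neg hc hcont.norm h1.norm_left
  exact (integrable_norm_iff (hcont.mono Ioi_subset_Ici_self
    |>.aestronglyMeasurable measurableSet_Ioi)).1 h2

theorem continuousOn_arc {φ₁ φ₂ r : ℝ} {F : ℂ → ℂ}
    (hF : ∀ φ ∈ Icc φ₁ φ₂, ContinuousAt F (polar r φ)) :
    ContinuousOn (fun φ : ℝ => F (polar r φ)) (Icc φ₁ φ₂) := fun φ hφ =>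
  (ContinuousAt.comp (f := fun φ : ℝ => polar r φ) (hF φ hφ)
    (continuous_polar.comp
      (by fun_prop : Continuous fun φ : ℝ => (r, φ))).continuousAt).continuousWithinAt

/-- A function with exponential decay is absolutely integrable along the boundary of a sector. -/
theorem sectorIntegrable_of_exp_decay {φ₁ φ₂ R c : ℝ} (hφ : φ₁ ≤ φ₂) {F : ℂ → ℂ}
    {S : Set ℂ} (hS : ∀ r, R ≤ r → ∀ φ ∈ Icc φ₁ φ₂, polar r φ ∈ S)
    (hF : ∀ z ∈ S, ContinuousAt F z) (hc : 0 < c)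
    (hO : F =O[cobounded ℂ ⊓ 𝓟 S] fun z => Real.exp (-c * ‖z‖)) :
    SectorIntegrable φ₁ φ₂ R F := by
  refine ⟨integrableOn_ray (fun r hr => hS r hr φ₂ ⟨hφ, le_rfl⟩) hF hc hO, ?_,
    integrableOn_ray (fun r hr => hS r hr φ₁ ⟨le_rfl, hφ⟩) hF hc hO⟩
  have := continuousOn_arc (r := R) fun φ hφ' => hF _ (hS R le_rfl φ hφ')
  exact (this.intervalIntegrable_of_Icc hφ).symm

/-- Cauchy's theorem for an unbounded sector and a function with exponential decay. -/
theorem sectorIntegral_eq_zero {φ₁ φ₂ R c : ℝ} (hR : 0 < R) (hφ : φ₁ ≤ φ₂) {F : ℂ → ℂ}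
    {S : Set ℂ} (hS : ∀ r, R ≤ r → ∀ φ ∈ Icc φ₁ φ₂, polar r φ ∈ S)
    (hd : ∀ z ∈ S, DifferentiableAt ℂ F z) (hc : 0 < c)
    (hO : F =O[cobounded ℂ ⊓ 𝓟 S] fun z => Real.exp (-c * ‖z‖)) :
    sectorIntegral φ₁ φ₂ R F = 0 := by
  have hint := sectorIntegrable_of_exp_decay hφ hS (fun z hz => (hd z hz).continuousAt) hc hO
  have harc : Tendsto (fun M : ℝ => ∫ φ in φ₁..φ₂, F (polar M φ) * (Complex.I * polar M φ))
      atTop (𝓝 0) := by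
    obtain ⟨C, hC⟩ := hO.bound
    rw [eventually_inf_principal, ← comap_norm_atTop, eventually_comap, eventually_atTop] at hC
    obtain ⟨N, hN⟩ := hC
    -- Bound of the integrand on the arc of radius `M`, times the length of that arc.
    have hlim : Tendsto (fun M : ℝ => C * Real.exp (-c * M) * M * |φ₂ - φ₁|) atTop (𝓝 0) := by
      have h1 := (Real.tendsto_pow_mul_exp_neg_atTop_nhds_zero 1).comp
        (tendsto_id.const_mul_atTop hc)
      have h2 := h1.const_mul (C * |φ₂ - φ₁| / c)
      rw [mul_zero] at h2
      refine h2.congr fun M => ?_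
      simp only [Function.comp, id, pow_one, neg_mul]
      field_simp
    refine squeeze_zero_norm' ?_ hlim
    filter_upwards [eventually_ge_atTop N, eventually_ge_atTop R] with M hM hMR
    have hM0 : 0 ≤ M := hR.le.trans hMR
    refine intervalIntegral.norm_integral_le_of_norm_le_const fun φ hφ' => ?_
    rw [uIoc_of_le hφ] at hφ'
    have := hN M hM (polar M φ) (norm_polar hM0 φ) (hS M hMR φ ⟨hφ'.1.le, hφ'.2⟩)
    rw [norm_mul, norm_mul, Complex.norm_I, one_mul, norm_polar hM0]
    rw [norm_polar hM0, Real.norm_of_nonneg (Real.exp_pos _).le] at this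
    exact mul_le_mul_of_nonneg_right this hM0
  have h2 := intervalIntegral_tendsto_integral_Ioi R
    (hint.1.mul_const (Complex.exp (φ₂ * Complex.I))) tendsto_id
  have h1 := intervalIntegral_tendsto_integral_Ioi R
    (hint.2.2.mul_const (Complex.exp (φ₁ * Complex.I))) tendsto_id
  have hlim := ((h2.neg.add_const
    (∫ φ in φ₂..φ₁, F (polar R φ) * (Complex.I * polar R φ))).add h1).add harc
  rw [add_zero] at hlim
  -- The truncated contour closed by the outer arc has integral zero for every `M ≥ R`, so the limit
  -- is zero too.
  refine tendsto_nhds_unique hlim (tendsto_const_nhds.congr' ?_)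
  filter_upwards [eventually_ge_atTop R] with M hM
  exact (annular_sector_cauchy hR hM hφ fun r hr φ hφ' => hd _ (hS r hr φ hφ')).symm

theorem SectorIntegrable.congr {φ₁ φ₂ R : ℝ} (hφ : φ₁ ≤ φ₂) {F G : ℂ → ℂ}
    (h : ∀ r, R ≤ r → ∀ φ ∈ Icc φ₁ φ₂, F (polar r φ) = G (polar r φ))
    (hF : SectorIntegrable φ₁ φ₂ R F) : SectorIntegrable φ₁ φ₂ R G := by
  refine ⟨hF.1.congr_fun (fun r hr => h r (le_of_lt hr) φ₂ ⟨hφ, le_rfl⟩) measurableSet_Ioi, ?_,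
    hF.2.2.congr_fun (fun r hr => h r (le_of_lt hr) φ₁ ⟨le_rfl, hφ⟩) measurableSet_Ioi⟩
  refine hF.2.1.congr fun φ hφ' => ?_
  rw [uIoc_of_ge hφ] at hφ'
  exact h R le_rfl φ ⟨hφ'.1.le, hφ'.2⟩

theorem SectorIntegrable.sub {φ₁ φ₂ R : ℝ} {F G : ℂ → ℂ}
    (hF : SectorIntegrable φ₁ φ₂ R F) (hG : SectorIntegrable φ₁ φ₂ R G) :
    SectorIntegrable φ₁ φ₂ R fun z => F z - G z :=
  ⟨hF.1.sub hG.1, hF.2.1.sub hG.2.1, hF.2.2.sub hG.2.2⟩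

theorem sectorIntegral_congr {φ₁ φ₂ R : ℝ} (hφ : φ₁ ≤ φ₂) {F G : ℂ → ℂ}
    (h : ∀ r, R ≤ r → ∀ φ ∈ Icc φ₁ φ₂, F (polar r φ) = G (polar r φ)) :
    sectorIntegral φ₁ φ₂ R F = sectorIntegral φ₁ φ₂ R G := by
  have h1 : ∀ φ ∈ Icc φ₁ φ₂, ∫ r in Ioi R, F (polar r φ) * Complex.exp (φ * Complex.I) =
      ∫ r in Ioi R, G (polar r φ) * Complex.exp (φ * Complex.I) := fun φ hφ' =>
    setIntegral_congr_fun measurableSet_Ioi fun r hr => by simp only [h r (le_of_lt hr) φ hφ']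
  have h2 : ∫ φ in φ₂..φ₁, F (polar R φ) * (Complex.I * polar R φ) =
      ∫ φ in φ₂..φ₁, G (polar R φ) * (Complex.I * polar R φ) := by
    refine intervalIntegral.integral_congr fun φ hφ' => ?_
    rw [uIcc_of_ge hφ] at hφ'
    simp only [h R le_rfl φ hφ']
  rw [sectorIntegral, sectorIntegral, h1 φ₁ ⟨le_rfl, hφ⟩, h1 φ₂ ⟨hφ, le_rfl⟩, h2]

theorem sectorIntegral_sub {φ₁ φ₂ R : ℝ} {F G : ℂ → ℂ}
    (hF : SectorIntegrable φ₁ φ₂ R F) (hG : SectorIntegrable φ₁ φ₂ R G) :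
    sectorIntegral φ₁ φ₂ R (fun z => F z - G z) =
      sectorIntegral φ₁ φ₂ R F - sectorIntegral φ₁ φ₂ R G := by
  have hc : Continuous fun φ : ℝ => Complex.I * polar R φ :=
    continuous_const.mul (continuous_polar.comp (by fun_prop : Continuous fun φ : ℝ => (R, φ)))
  simp only [sectorIntegral, sub_mul]
  rw [integral_sub (hF.1.mul_const _) (hG.1.mul_const _),
    integral_sub (hF.2.2.mul_const _) (hG.2.2.mul_const _),
    intervalIntegral.integral_sub (hF.2.1.mul_continuousOn hc.continuousOn)
      (hG.2.1.mul_continuousOn hc.continuousOn)]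
  ring

/-! ### Geometry of the regions `D_R^±` -/

/-- With `z = x + iy` and `κ = Im a / Re a`, the condition reads `x² ≤ y² + 2κxy`. Estimating `2κxy
≤ x²/2 + 2κ²y²`, which is `(x - 2κy)² ≥ 0`, gives `x² + y² ≤ (3 + 4κ²) y²`. -/
theorem exists_mul_norm_le_abs_im {a : ℂ} (ha : 0 < a.re) :
    ∃ c : ℝ, 0 < c ∧ ∀ z : ℂ, (a * z ^ 2).re ≤ 0 → c * ‖z‖ ≤ |z.im| := by
  set κ := a.im / a.re
  have hκ : a.im = κ * a.re := by simp only [κ]; field_simp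
  have hK : 0 < 3 + 4 * κ ^ 2 := by positivity
  refine ⟨(Real.sqrt (3 + 4 * κ ^ 2))⁻¹, by positivity, fun z hz => ?_⟩
  rw [inv_mul_le_iff₀ (Real.sqrt_pos.2 hK), ← abs_norm z, ← sq_le_sq₀ (abs_nonneg _) (by positivity),
    mul_pow, Real.sq_sqrt hK.le, sq_abs, sq_abs, Complex.sq_norm, Complex.normSq_apply]
  have h1 : (a * z ^ 2).re = a.re * (z.re ^ 2 - z.im ^ 2 - 2 * κ * z.re * z.im) := by
    simp only [pow_two, Complex.mul_re, Complex.mul_im, hκ]; ring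
  rw [h1] at hz
  have h2 : z.re ^ 2 - z.im ^ 2 - 2 * κ * z.re * z.im ≤ 0 := by
    by_contra! h
    exact absurd (mul_pos ha h) (not_lt.2 hz)
  nlinarith [sq_nonneg (z.re - 2 * κ * z.im)]

theorem re_mul_polar_sq (a : ℂ) (r φ : ℝ) :
    (a * polar r φ ^ 2).re = ‖a‖ * r ^ 2 * Real.cos (a.arg + 2 * φ) := by
  have h : a * polar r φ ^ 2 =
      ((‖a‖ * r ^ 2 : ℝ) : ℂ) * Complex.exp ((a.arg + 2 * φ : ℝ) * Complex.I) := by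
    conv_lhs => rw [← Complex.norm_mul_exp_arg_mul_I a, polar]
    rw [mul_pow, ← Complex.exp_nat_mul, mul_mul_mul_comm, ← Complex.exp_add]
    push_cast
    ring_nf
  rw [h, Complex.re_ofReal_mul, Complex.exp_ofReal_mul_I_re]

theorem re_mul_polar_sq_neg {a : ℂ} (ha : 0 < a.re) {r φ : ℝ} (hr : 0 < r)
    (hφ : φ ∈ Ioo (angle a) (angle a + Real.pi / 2)) : (a * polar r φ ^ 2).re < 0 := by
  rw [re_mul_polar_sq]
  have ha0 : a ≠ 0 := by rintro rfl; simp at ha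
  have h := Real.cos_neg_of_pi_div_two_lt_of_lt (x := a.arg + 2 * φ)
    (by have := hφ.1; unfold angle at this; linarith)
    (by have := hφ.2; unfold angle at this; linarith)
  have : 0 < ‖a‖ := norm_pos_iff.2 ha0
  exact mul_neg_of_pos_of_neg (by positivity) h

theorem angle_mem {a : ℂ} (ha : 0 < a.re) : angle a ∈ Ioo 0 (Real.pi / 2) := by
  have h := abs_lt.1 (Complex.abs_arg_lt_pi_div_two_iff.2 (Or.inl ha))
  unfold angle
  constructor <;> linarith [h.1, h.2]

theorem polar_mem_Dplus {a : ℂ} (ha : 0 < a.re) {R r φ : ℝ} (hR : 0 < R) (hr : R < r)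
    (hφ : φ ∈ Ioo (angle a) (angle a + Real.pi / 2)) : polar r φ ∈ Dplus a R := by
  have hr0 := hR.trans hr
  refine ⟨by rwa [norm_polar hr0.le], re_mul_polar_sq_neg ha hr0 hφ, ?_⟩
  rw [polar_im]
  have := angle_mem ha
  exact mul_pos hr0 (Real.sin_pos_of_pos_of_lt_pi (this.1.trans hφ.1) (by linarith [hφ.2, this.2]))

theorem polar_add_pi (r φ : ℝ) : polar r (φ + Real.pi) = -polar r φ := by
  simp [polar, add_mul, Complex.exp_add]

theorem neg_mem_Dminus_iff {a z : ℂ} {R : ℝ} : -z ∈ Dminus a R ↔ z ∈ Dplus a R := by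
  simp [Dplus, Dminus]

theorem polar_mem_Dminus {a : ℂ} (ha : 0 < a.re) {R r φ : ℝ} (hR : 0 < R) (hr : R < r)
    (hφ : φ ∈ Ioo (angle a + Real.pi) (angle a + Real.pi / 2 + Real.pi)) :
    polar r φ ∈ Dminus a R := by
  rw [← sub_add_cancel φ Real.pi, polar_add_pi, neg_mem_Dminus_iff]
  exact polar_mem_Dplus ha hR hr ⟨by linarith [hφ.1], by linarith [hφ.2]⟩

/-- The contour consists of boundary points, so the estimates are needed on the closure; a
continuous map sends the closure of the open parameter rectangle into the closure of its image. -/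
theorem polar_mem_closure {φ₁ φ₂ R : ℝ} (hφ : φ₁ < φ₂) {D : Set ℂ}
    (hD : ∀ r, R < r → ∀ φ ∈ Ioo φ₁ φ₂, polar r φ ∈ D) (r : ℝ) (hr : R ≤ r) (φ : ℝ)
    (hφ' : φ ∈ Icc φ₁ φ₂) : polar r φ ∈ closure D := by
  have h : (r, φ) ∈ closure (Ioi R ×ˢ Ioo φ₁ φ₂) := by
    rw [closure_prod_eq, closure_Ioi, closure_Ioo hφ.ne]
    exact ⟨hr, hφ'⟩
  have h1 := image_closure_subset_closure_image continuous_polar (mem_image_of_mem _ h)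
  refine closure_mono ?_ h1
  rintro _ ⟨p, hp, rfl⟩
  exact hD _ hp.1 _ hp.2

/-- The strict inequality `0 < Im z` survives passage to the closure because `Im z ≥ c‖z‖ ≥ cR > 0`:
the real axis could be touched only at the origin, which is cut off. -/
theorem closure_Dplus_subset {a : ℂ} (ha : 0 < a.re) {R : ℝ} (hR : 0 < R) :
    closure (Dplus a R) ⊆ {z | R ≤ ‖z‖ ∧ (a * z ^ 2).re ≤ 0 ∧ 0 < z.im} := by
  have h : closure (Dplus a R) ⊆ {z | R ≤ ‖z‖ ∧ (a * z ^ 2).re ≤ 0 ∧ 0 ≤ z.im} := by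
    refine closure_minimal (fun z hz => ⟨hz.1.le, hz.2.1.le, hz.2.2.le⟩) ?_
    refine (isClosed_le continuous_const continuous_norm).inter
      (IsClosed.inter
        (isClosed_le (f := fun z : ℂ => (a * z ^ 2).re)
          (Complex.continuous_re.comp (by fun_prop)) continuous_const)
        (isClosed_le continuous_const Complex.continuous_im))
  obtain ⟨c, hc, hcz⟩ := exists_mul_norm_le_abs_im ha
  intro z hz
  obtain ⟨h1, h2, h3⟩ := h hz
  have := hcz z h2
  rw [abs_of_nonneg h3] at this
  exact ⟨h1, h2, (mul_pos hc (hR.trans_le h1)).trans_le this⟩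

theorem closure_Dminus_subset {a : ℂ} (ha : 0 < a.re) {R : ℝ} (hR : 0 < R) :
    closure (Dminus a R) ⊆ {z | R ≤ ‖z‖ ∧ (a * z ^ 2).re ≤ 0 ∧ z.im < 0} := by
  intro z hz
  have h1 : Dminus a R = -Dplus a R := by
    ext z; rw [Set.mem_neg, ← neg_mem_Dminus_iff, neg_neg]
  rw [h1, ← neg_closure, Set.mem_neg] at hz
  simpa using closure_Dplus_subset ha hR hz

/-! ### Exponential polynomials and the zeros of `Δ` -/

noncomputable section

/-- The monomials `e^{-iωz} z^{-k}`, indexed by `(ω, k)`. -/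
def expMonomial (z : ℂ) : Multiplicative (ℝ × ℕ) →* ℂ where
  toFun p := Complex.exp (-Complex.I * z * p.toAdd.1) * z⁻¹ ^ p.toAdd.2
  map_one' := by simp
  map_mul' p q := by
    simp only [toAdd_mul, Prod.fst_add, Prod.snd_add, pow_add, Complex.ofReal_add, mul_add,
      Complex.exp_add]
    ring

/-- Evaluation at `z` of a formal linear combination of the monomials `e^{-iωz} z^{-k}`. -/
def evalExp (z : ℂ) : AddMonoidAlgebra ℂ (ℝ × ℕ) →ₐ[ℂ] ℂ :=
  AddMonoidAlgebra.lift ℂ ℂ (ℝ × ℕ) (expMonomial z)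

theorem evalExp_single (z : ℂ) (p : ℝ × ℕ) (c : ℂ) :
    evalExp z (AddMonoidAlgebra.single p c) =
      c * (Complex.exp (-Complex.I * z * p.1) * z⁻¹ ^ p.2) := by
  rw [evalExp, AddMonoidAlgebra.lift_single]
  rfl

theorem evalExp_eq_sum (z : ℂ) (P : AddMonoidAlgebra ℂ (ℝ × ℕ)) :
    evalExp z P = ∑ p ∈ P.coeff.support,
      P.coeff p * (Complex.exp (-Complex.I * z * p.1) * z⁻¹ ^ p.2) := by
  rw [evalExp, AddMonoidAlgebra.lift_apply]
  rfl

/-- A monomial of smaller exponential type in the direction `s` is negligible. -/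
theorem tendsto_monomial_zero {s c : ℝ} (hs : s ^ 2 = 1) (hc : 0 < c) {p d : ℝ × ℕ}
    (h : s * p.1 < s * d.1 ∨ p.1 = d.1 ∧ d.2 < p.2) :
    Tendsto (fun z : ℂ => (Complex.exp (-Complex.I * z * p.1) * z⁻¹ ^ p.2) *
        (Complex.exp (Complex.I * z * d.1) * z ^ d.2))
      (cobounded ℂ ⊓ 𝓟 {z | c * ‖z‖ ≤ s * z.im}) (𝓝 0) := by
  have hn : Tendsto (fun z : ℂ => ‖z‖) (cobounded ℂ ⊓ 𝓟 {z | c * ‖z‖ ≤ s * z.im}) atTop :=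
    tendsto_norm_cobounded_atTop.mono_left inf_le_left
  rcases h with h | ⟨h1, h2⟩
  -- The quotient of the exponentials has modulus `e^{-(sω_d - sω_p)(s Im z)}`, at most `e^{-δ‖z‖}`
  -- in the cone; this beats the remaining power of `‖z‖`.
  · have hδ : 0 < (s * d.1 - s * p.1) * c := mul_pos (sub_pos.2 h) hc
    set δ := (s * d.1 - s * p.1) * c with hδ'
    have hlim : Tendsto (fun x : ℝ => x ^ d.2 * Real.exp (-(δ * x))) atTop (𝓝 0) := by
      have h1 := ((Real.tendsto_pow_mul_exp_neg_atTop_nhds_zero d.2).comp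
        (tendsto_id.const_mul_atTop hδ)).const_mul ((δ ^ d.2)⁻¹)
      rw [mul_zero] at h1
      refine h1.congr fun x => ?_
      simp only [Function.comp, id, mul_pow]
      field_simp
    refine squeeze_zero_norm' ?_ (hlim.comp hn)
    filter_upwards [hn.eventually_ge_atTop 1, mem_inf_of_right (mem_principal_self _)] with z hz1 hz
    have hz' : c * ‖z‖ ≤ s * z.im := hz
    have e1 : ‖Complex.exp (-Complex.I * z * p.1)‖ * ‖Complex.exp (Complex.I * z * d.1)‖ =
        Real.exp (-((s * d.1 - s * p.1) * (s * z.im))) := by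
      rw [Complex.norm_exp, Complex.norm_exp, ← Real.exp_add]
      congr 1
      simp
      linear_combination (d.1 - p.1) * z.im * hs
    have e2 : ‖z⁻¹ ^ p.2‖ ≤ 1 := by
      rw [norm_pow, norm_inv]
      exact pow_le_one₀ (by positivity) (inv_le_one_of_one_le₀ hz1)
    have e3 : Real.exp (-((s * d.1 - s * p.1) * (s * z.im))) ≤ Real.exp (-(δ * ‖z‖)) := by
      rw [Real.exp_le_exp, neg_le_neg_iff, hδ', mul_assoc]
      exact mul_le_mul_of_nonneg_left hz' (sub_pos.2 h).le
    calc ‖(Complex.exp (-Complex.I * z * p.1) * z⁻¹ ^ p.2) *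
          (Complex.exp (Complex.I * z * d.1) * z ^ d.2)‖
        = (‖Complex.exp (-Complex.I * z * p.1)‖ * ‖Complex.exp (Complex.I * z * d.1)‖) *
            (‖z⁻¹ ^ p.2‖ * ‖z‖ ^ d.2) := by
          simp only [norm_mul, norm_pow]; ring
      _ ≤ Real.exp (-(δ * ‖z‖)) * (1 * ‖z‖ ^ d.2) := by
          rw [e1]; gcongr
      _ = ‖z‖ ^ d.2 * Real.exp (-(δ * ‖z‖)) := by ring
  · obtain ⟨k, hk⟩ := Nat.exists_eq_add_of_lt h2
    have hlim : Tendsto (fun z : ℂ => z⁻¹ ^ (k + 1))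
        (cobounded ℂ ⊓ 𝓟 {z | c * ‖z‖ ≤ s * z.im}) (𝓝 0) := by
      have := ((tendsto_inv₀_cobounded (α := ℂ)).mono_left
        (inf_le_left (b := 𝓟 {z : ℂ | c * ‖z‖ ≤ s * z.im}))).pow (k + 1)
      rwa [zero_pow (Nat.succ_ne_zero k)] at this
    refine hlim.congr' ?_
    filter_upwards [hn.eventually_ge_atTop 1] with z hz1
    have hz : z ≠ 0 := norm_pos_iff.1 (one_pos.trans_le hz1)
    have e1 : Complex.exp (-Complex.I * z * p.1) * Complex.exp (Complex.I * z * d.1) = 1 := by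
      rw [← Complex.exp_add, h1]; simp
    have e2 : z⁻¹ ^ d.2 * z ^ d.2 = 1 := by rw [← mul_pow, inv_mul_cancel₀ hz, one_pow]
    rw [hk, add_assoc, pow_add]
    linear_combination (-z⁻¹ ^ (k + 1)) * (e1 * (z⁻¹ ^ d.2 * z ^ d.2)) - z⁻¹ ^ (k + 1) * e2

/-- Divided by its dominant monomial, the sum tends to the coefficient of that monomial, which is
nonzero. -/
theorem eventually_evalExp_ne_zero {s c : ℝ} (hs : s ^ 2 = 1) (hc : 0 < c)
    {P : AddMonoidAlgebra ℂ (ℝ × ℕ)} (hP : P ≠ 0) :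
    ∀ᶠ z in cobounded ℂ ⊓ 𝓟 {z | c * ‖z‖ ≤ s * z.im}, evalExp z P ≠ 0 := by
  have hs0 : s ≠ 0 := by rintro rfl; norm_num at hs
  have hne : P.coeff.support.Nonempty := by
    rw [Finsupp.support_nonempty_iff]
    intro h
    exact hP (by ext; simp [h])
  -- Since `|e^{-iωz}| = e^{(sω)(s Im z)}`, the dominant term has the largest `sω` and, among those,
  -- the smallest power of `z⁻¹`; hence the lexicographic order with the second entry negated.
  obtain ⟨d, hd, hmax⟩ := Finset.exists_max_image P.coeff.support
    (fun p => toLex ((s * p.1 : ℝ), (-(p.2 : ℤ)))) hne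
  have hlim : Tendsto (fun z : ℂ => evalExp z P * (Complex.exp (Complex.I * z * d.1) * z ^ d.2))
      (cobounded ℂ ⊓ 𝓟 {z | c * ‖z‖ ≤ s * z.im}) (𝓝 (P.coeff d)) := by
    have hsum : ∑ p ∈ P.coeff.support, (if p = d then P.coeff d else 0) = P.coeff d := by
      rw [Finset.sum_ite_eq' _ _ _, if_pos hd]
    rw [← hsum]
    simp only [evalExp_eq_sum, Finset.sum_mul]
    refine tendsto_finsetSum _ fun p hp => ?_
    split_ifs with hpd
    · subst hpd
      refine tendsto_const_nhds.congr' ?_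
      have h0 : ∀ᶠ z : ℂ in cobounded ℂ ⊓ 𝓟 {z | c * ‖z‖ ≤ s * z.im}, z ≠ 0 :=
        (eventually_ne_cobounded 0).filter_mono inf_le_left
      filter_upwards [h0] with z hz
      have e1 : Complex.exp (-Complex.I * z * p.1) * Complex.exp (Complex.I * z * p.1) = 1 := by
        rw [← Complex.exp_add]; simp
      have e2 : z⁻¹ ^ p.2 * z ^ p.2 = 1 := by rw [← mul_pow, inv_mul_cancel₀ hz, one_pow]
      linear_combination (-P.coeff p) * (e1 * (z⁻¹ ^ p.2 * z ^ p.2)) - P.coeff p * e2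
    · have h := hmax p hp
      rw [Prod.Lex.toLex_le_toLex] at h
      have h' : s * p.1 < s * d.1 ∨ p.1 = d.1 ∧ d.2 < p.2 := by
        rcases h with h | ⟨h1, h2⟩
        · exact Or.inl h
        · have h1 := mul_left_cancel₀ hs0 h1
          refine Or.inr ⟨h1, lt_of_le_of_ne (by simpa using h2) fun h3 => hpd ?_⟩
          exact Prod.ext h1 h3.symm
      have := (tendsto_monomial_zero hs hc h').const_mul (P.coeff p)
      rw [mul_zero] at this
      simpa only [mul_assoc] using this
  filter_upwards [hlim.eventually_ne (Finsupp.mem_support_iff.1 hd)] with z hz h0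
  simp [h0] at hz

variable {m : ℕ}

/-- The matrix `𝒜`, with entries in the algebra of exponential polynomials. -/
def symbA (η : Fin (m + 1) → ℝ) (b : Fin 2 → Fin 2 → Fin (m + 1) → ℂ) :
    Matrix (Fin (m + 1) × Fin 2) (Fin (m + 1) × Fin 2) (AddMonoidAlgebra ℂ (ℝ × ℕ)) :=
  Matrix.of fun row col =>
    Fin.cases (motive := fun _ => AddMonoidAlgebra ℂ (ℝ × ℕ))
      (if row.2 = 0 then
        AddMonoidAlgebra.single (-η row.1, 1) (b 0 col.2 row.1 / (2 * Complex.I)) +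
          AddMonoidAlgebra.single (-η row.1, 0) (b 1 col.2 row.1 / 2)
      else AddMonoidAlgebra.single (η row.1, 1) (-(b 0 col.2 row.1 / (2 * Complex.I))) +
          AddMonoidAlgebra.single (η row.1, 0) (b 1 col.2 row.1 / 2))
      (fun r => if row.2 = col.2 then
          (if row.1 = r.succ then 1 else if row.1 = r.castSucc then -1 else 0)
        else 0)
      col.1

/-- Evaluation is an algebra homomorphism and so commutes with the determinant. A single nonzero
value of `Δ` therefore forces the formal determinant to be nonzero. The identity also holds at `z =
0`, where both sides use `0⁻¹ = 0`. -/
theorem Delta_eq_evalExp (η : Fin (m + 1) → ℝ) (b : Fin 2 → Fin 2 → Fin (m + 1) → ℂ) (z : ℂ) :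
    Delta η b z = evalExp z (symbA η b).det := by
  rw [Delta, AlgHom.map_det]
  congr 1
  ext ⟨j, p⟩ ⟨l, k⟩
  rw [AlgHom.mapMatrix_apply, Matrix.map_apply]
  refine Fin.cases ?_ (fun r => ?_) l
  · simp only [matA, symbA, Matrix.of_apply, Fin.cases_zero, B, E]
    split_ifs
    · simp only [map_add, evalExp_single]
      simp [div_eq_mul_inv, Complex.inv_I]
      ring
    · simp only [map_add, evalExp_single]
      simp [div_eq_mul_inv, Complex.inv_I]
      ring
  · simp only [matA, symbA, Matrix.of_apply, Fin.cases_succ]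
    split_ifs <;> simp

theorem eventually_Delta_ne_zero {η : Fin (m + 1) → ℝ} {b : Fin 2 → Fin 2 → Fin (m + 1) → ℂ}
    (hΔ : ∃ z : ℂ, z ≠ 0 ∧ Delta η b z ≠ 0) {s c : ℝ} (hs : s ^ 2 = 1) (hc : 0 < c) :
    ∀ᶠ z in cobounded ℂ ⊓ 𝓟 {z | c * ‖z‖ ≤ s * z.im}, Delta η b z ≠ 0 := by
  obtain ⟨z₀, -, hz₀⟩ := hΔ
  simp only [Delta_eq_evalExp] at hz₀ ⊢
  exact eventually_evalExp_ne_zero hs hc fun h => hz₀ (by rw [h, map_zero])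

/-- For large `R`, the determinant has no zeros in the closures of `D_R^±`. -/
theorem exists_Delta_ne_zero {a : ℂ} (ha : 0 < a.re) {η : Fin (m + 1) → ℝ}
    {b : Fin 2 → Fin 2 → Fin (m + 1) → ℂ} (hΔ : ∃ z : ℂ, z ≠ 0 ∧ Delta η b z ≠ 0) :
    ∃ R₀ : ℝ, 0 < R₀ ∧ ∀ z : ℂ, R₀ ≤ ‖z‖ → (a * z ^ 2).re ≤ 0 → Delta η b z ≠ 0 := by
  obtain ⟨c, hc, hcz⟩ := exists_mul_norm_le_abs_im ha
  -- The signs `s = 1` and `s = -1` treat the upper and the lower half of the cone.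
  have h1 := eventually_Delta_ne_zero hΔ (s := 1) (by norm_num) hc
  have h2 := eventually_Delta_ne_zero hΔ (s := -1) (by norm_num) hc
  rw [eventually_inf_principal, ← comap_norm_atTop, eventually_comap] at h1 h2
  obtain ⟨R, hR⟩ := eventually_atTop.1 (h1.and h2)
  refine ⟨max R 1, by positivity, fun z hz hre => ?_⟩
  have h := hR ‖z‖ ((le_max_left _ _).trans hz)
  have h3 := hcz z hre
  rcases abs_cases z.im with ⟨h4, -⟩ | ⟨h4, -⟩
  · exact h.1 z rfl (by rw [mem_ofPred_eq, one_mul, ← h4]; exact h3)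
  · exact h.2 z rfl (by rw [mem_ofPred_eq, neg_one_mul, ← h4]; exact h3)

end

/-! ### The global relation and the linear system for the boundary transforms -/

theorem intervalIntegral_swap_of_continuousOn {α β γ δ : ℝ} (hαβ : α ≤ β) (hγδ : γ ≤ δ)
    {F : ℝ → ℝ → ℂ} (hF : ContinuousOn (Function.uncurry F) (Icc α β ×ˢ Icc γ δ)) :
    ∫ x in α..β, ∫ s in γ..δ, F x s = ∫ s in γ..δ, ∫ x in α..β, F x s := by
  simp only [intervalIntegral.integral_of_le hγδ]
  refine intervalIntegral_integral_swap ?_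
  rw [Measure.prod_restrict, uIoc_of_le hαβ]
  exact (hF.integrableOn_compact (isCompact_Icc.prod isCompact_Icc)).mono_set
    (prod_mono Ioc_subset_Icc_self Ioc_subset_Icc_self)

section

variable {m : ℕ} {a : ℂ} {η : Fin (m + 1) → ℝ} {b : Fin 2 → Fin 2 → Fin (m + 1) → ℂ}
  {T : ℝ} {q₀ : ℝ → ℂ} {g : Fin 2 → ℝ → ℂ} {q : ℝ → ℝ → ℂ}

theorem dx_zero (q : ℝ → ℝ → ℂ) (x t : ℝ) : dx q 0 x t = q x t := by
  simp [dx, iteratedDerivWithin_zero]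

theorem IsSolution.hasDerivAt_dx (h : IsSolution a η b T q₀ g q) {k : ℕ} (hk : k < 2) {x t : ℝ}
    (hx : x ∈ Ioo (0 : ℝ) 1) (ht : t ∈ Icc 0 T) :
    HasDerivAt (fun y => dx q k y t) (dx q (k + 1) x t) x := by
  have hd := (h.contDiffOn t ht).differentiableOn_iteratedDerivWithin (m := k)
    (by exact_mod_cast hk) (uniqueDiffOn_Icc zero_lt_one)
  have h1 := (hd x (Ioo_subset_Icc_self hx)).hasDerivWithinAt
  rw [← iteratedDerivWithin_succ] at h1
  exact h1.hasDerivAt (Icc_mem_nhds hx.1 hx.2)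

theorem IsSolution.continuousOn_dx_left (h : IsSolution a η b T q₀ g q) {k : ℕ} (hk : k ≤ 2)
    {t : ℝ} (ht : t ∈ Icc 0 T) : ContinuousOn (fun x => dx q k x t) (Icc 0 1) :=
  (h.continuousOn k hk).comp (f := fun x : ℝ => (x, t)) (by fun_prop) fun _ hx => ⟨hx, ht⟩

theorem IsSolution.continuousOn_dx_right (h : IsSolution a η b T q₀ g q) {k : ℕ} (hk : k ≤ 2)
    {x : ℝ} (hx : x ∈ Icc (0 : ℝ) 1) : ContinuousOn (fun t => dx q k x t) (Icc 0 T) :=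
  (h.continuousOn k hk).comp (f := fun t : ℝ => (x, t)) (by fun_prop) fun _ ht => ⟨hx, ht⟩

/-- Integration of the equation in time at an interior point. -/
theorem IsSolution.integral_time (h : IsSolution a η b T q₀ g q) {x τ : ℝ}
    (hx : x ∈ Ioo (0 : ℝ) 1) (hτ : τ ∈ Icc 0 T) (z : ℂ) :
    ∫ s in (0 : ℝ)..τ, Complex.exp (a * z ^ 2 * s) * (a * z ^ 2 * dx q 0 x s + a * dx q 2 x s) =
      Complex.exp (a * z ^ 2 * τ) * q x τ - q₀ x := by
  have hx' := Ioo_subset_Icc_self hx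
  have hsub : Icc 0 τ ⊆ Icc 0 T := Icc_subset_Icc_right hτ.2
  have h0 := (h.continuousOn_dx_right (k := 0) (by norm_num) hx').mono hsub
  have h2 := (h.continuousOn_dx_right (k := 2) le_rfl hx').mono hsub
  have hexp : Continuous fun s : ℝ => Complex.exp (a * z ^ 2 * s) := by fun_prop
  have hq : ContinuousOn (fun s => q x s) (Icc 0 τ) := by simpa only [dx_zero] using h0
  rw [intervalIntegral.integral_eq_sub_of_hasDerivAt_of_le
    (f := fun s : ℝ => Complex.exp (a * z ^ 2 * s) * q x s) hτ.1
    (hexp.continuousOn.mul hq) ?_ ?_]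
  · simp [h.initial x hx']
  · intro s hs
    have h1 := h.pde x hx s ⟨hs.1, hs.2.trans_le hτ.2⟩
    have h3 : HasDerivAt (fun s : ℝ => Complex.exp (a * z ^ 2 * s))
        (Complex.exp (a * z ^ 2 * s) * (a * z ^ 2)) s := by
      have := ((Complex.ofRealCLM.hasDerivAt (x := s)).const_mul (a * z ^ 2)).cexp
      simpa using this
    refine (h3.mul h1).congr_deriv ?_
    rw [dx_zero, neg_sq, Complex.I_sq]
    ring
  · refine ContinuousOn.intervalIntegrable_of_Icc hτ.1 ?_
    exact hexp.continuousOn.mul ((continuousOn_const.mul h0).add (continuousOn_const.mul h2))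

/-- Integration of the divergence form in space at a fixed time. -/
theorem IsSolution.integral_space (h : IsSolution a η b T q₀ g q) {α β t : ℝ} (hα : 0 ≤ α)
    (hαβ : α ≤ β) (hβ : β ≤ 1) (ht : t ∈ Icc 0 T) (z : ℂ) :
    ∫ x in α..β, Complex.exp (-Complex.I * z * x) *
        (a * z ^ 2 * dx q 0 x t + a * dx q 2 x t) =
      Complex.exp (-Complex.I * z * β) * (c a z 0 * dx q 0 β t + c a z 1 * dx q 1 β t) -
        Complex.exp (-Complex.I * z * α) * (c a z 0 * dx q 0 α t + c a z 1 * dx q 1 α t) := by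
  have hsub : Icc α β ⊆ Icc 0 1 := Icc_subset_Icc hα hβ
  have hk : ∀ k ≤ 2, ContinuousOn (fun x => dx q k x t) (Icc α β) := fun k hk =>
    (h.continuousOn_dx_left hk ht).mono hsub
  have hexp : Continuous fun x : ℝ => Complex.exp (-Complex.I * z * x) := by fun_prop
  rw [intervalIntegral.integral_eq_sub_of_hasDerivAt_of_le
    (f := fun x : ℝ => Complex.exp (-Complex.I * z * x) *
      (c a z 0 * dx q 0 x t + c a z 1 * dx q 1 x t)) hαβ
    (hexp.continuousOn.mul ((continuousOn_const.mul (hk 0 (by norm_num))).add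
      (continuousOn_const.mul (hk 1 (by norm_num))))) ?_ ?_]
  · intro x hx
    have hx' : x ∈ Ioo (0 : ℝ) 1 := ⟨hα.trans_lt hx.1, hx.2.trans_le hβ⟩
    have h0 := h.hasDerivAt_dx (k := 0) (by norm_num) hx' ht
    have h1 := h.hasDerivAt_dx (k := 1) (by norm_num) hx' ht
    have h3 : HasDerivAt (fun x : ℝ => Complex.exp (-Complex.I * z * x))
        (Complex.exp (-Complex.I * z * x) * (-Complex.I * z)) x := by
      have := ((Complex.ofRealCLM.hasDerivAt (x := x)).const_mul (-Complex.I * z)).cexp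
      simpa using this
    refine (h3.mul ((h0.const_mul (c a z 0)).add (h1.const_mul (c a z 1)))).congr_deriv ?_
    simp only [c, if_true, one_ne_zero, if_false, Pi.add_apply]
    linear_combination (-Complex.exp (-Complex.I * z * x) * a * z ^ 2 * dx q 0 x t) *
      Complex.I_sq
  · refine ContinuousOn.intervalIntegrable_of_Icc hαβ ?_
    exact hexp.continuousOn.mul ((continuousOn_const.mul (hk 0 (by norm_num))).add
      (continuousOn_const.mul (hk 2 le_rfl)))

/-- The global relation on `[α, β] × [0, τ]`. -/
theorem IsSolution.global_relation (h : IsSolution a η b T q₀ g q) {α β τ : ℝ} (hα : 0 ≤ α)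
    (hαβ : α ≤ β) (hβ : β ≤ 1) (hτ : τ ∈ Icc 0 T) (z : ℂ) :
    Complex.exp (a * z ^ 2 * τ) * (∫ x in α..β, Complex.exp (-Complex.I * z * x) * q x τ) -
        (∫ x in α..β, Complex.exp (-Complex.I * z * x) * q₀ x) =
      Complex.exp (-Complex.I * z * β) *
          (c a z 0 * (∫ s in (0 : ℝ)..τ, Complex.exp (a * z ^ 2 * s) * dx q 0 β s) +
            c a z 1 * ∫ s in (0 : ℝ)..τ, Complex.exp (a * z ^ 2 * s) * dx q 1 β s) -
        Complex.exp (-Complex.I * z * α) *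
          (c a z 0 * (∫ s in (0 : ℝ)..τ, Complex.exp (a * z ^ 2 * s) * dx q 0 α s) +
            c a z 1 * ∫ s in (0 : ℝ)..τ, Complex.exp (a * z ^ 2 * s) * dx q 1 α s) := by
  have hsub : Icc α β ⊆ Icc 0 1 := Icc_subset_Icc hα hβ
  have hsubτ : Icc 0 τ ⊆ Icc 0 T := Icc_subset_Icc_right hτ.2
  have hexp : Continuous fun x : ℝ => Complex.exp (-Complex.I * z * x) := by fun_prop
  have hexpt : Continuous fun s : ℝ => Complex.exp (a * z ^ 2 * s) := by fun_prop
  have hT : (0 : ℝ) ∈ Icc 0 T := ⟨le_rfl, hτ.1.trans hτ.2⟩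
  have hqτ : IntervalIntegrable (fun x => Complex.exp (-Complex.I * z * x) * q x τ) volume α β :=
    (hexp.continuousOn.mul ((h.contDiffOn τ hτ).continuousOn.mono hsub)).intervalIntegrable_of_Icc
      hαβ
  have hq0 : IntervalIntegrable (fun x => Complex.exp (-Complex.I * z * x) * q₀ x) volume α β :=
    (hexp.continuousOn.mul (((h.contDiffOn 0 hT).continuousOn.congr
      fun x hx => (h.initial x hx).symm).mono hsub)).intervalIntegrable_of_Icc hαβ
  have hint : ∀ k ≤ 1, ∀ y ∈ Icc (0 : ℝ) 1, IntervalIntegrable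
      (fun s => Complex.exp (a * z ^ 2 * s) * dx q k y s) volume 0 τ := fun k hk y hy =>
    (hexpt.continuousOn.mul ((h.continuousOn_dx_right (hk.trans (by norm_num)) hy).mono
      hsubτ)).intervalIntegrable_of_Icc hτ.1
  -- Integrating first in time uses the equation and leaves the values at times `0` and `τ`;
  -- integrating first in space uses the divergence form and leaves the values at `α` and `β`.
  have hswap := intervalIntegral_swap_of_continuousOn hαβ hτ.1
    (F := fun x s => Complex.exp (-Complex.I * z * x) * (Complex.exp (a * z ^ 2 * s) *
      (a * z ^ 2 * dx q 0 x s + a * dx q 2 x s))) (by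
    have h0 := (h.continuousOn 0 (by norm_num)).mono (prod_mono hsub hsubτ)
    have h2 := (h.continuousOn 2 le_rfl).mono (prod_mono hsub hsubτ)
    exact (hexp.comp continuous_fst).continuousOn.mul ((hexpt.comp continuous_snd).continuousOn.mul
      ((continuousOn_const.mul h0).add (continuousOn_const.mul h2))))
  have hleft : ∫ x in α..β, ∫ s in (0 : ℝ)..τ, Complex.exp (-Complex.I * z * x) *
      (Complex.exp (a * z ^ 2 * s) * (a * z ^ 2 * dx q 0 x s + a * dx q 2 x s)) =
      Complex.exp (a * z ^ 2 * τ) * (∫ x in α..β, Complex.exp (-Complex.I * z * x) * q x τ) -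
        (∫ x in α..β, Complex.exp (-Complex.I * z * x) * q₀ x) := by
    rw [← intervalIntegral.integral_const_mul,
      ← intervalIntegral.integral_sub (hqτ.const_mul _) hq0]
    -- The equation is only assumed at interior `x`; the end points are a null set.
    refine intervalIntegral.integral_congr_Ioo_of_le hαβ fun x hx => ?_
    simp only [intervalIntegral.integral_const_mul]
    rw [h.integral_time ⟨hα.trans_lt hx.1, hx.2.trans_le hβ⟩ hτ]
    ring
  have hright : ∫ s in (0 : ℝ)..τ, ∫ x in α..β, Complex.exp (-Complex.I * z * x) *
      (Complex.exp (a * z ^ 2 * s) * (a * z ^ 2 * dx q 0 x s + a * dx q 2 x s)) =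
      ∫ s in (0 : ℝ)..τ,
        (Complex.exp (-Complex.I * z * β) * (c a z 0 * (Complex.exp (a * z ^ 2 * s) * dx q 0 β s) +
          c a z 1 * (Complex.exp (a * z ^ 2 * s) * dx q 1 β s)) -
        Complex.exp (-Complex.I * z * α) * (c a z 0 * (Complex.exp (a * z ^ 2 * s) * dx q 0 α s) +
          c a z 1 * (Complex.exp (a * z ^ 2 * s) * dx q 1 α s))) := by
    refine intervalIntegral.integral_congr fun s hs => ?_
    rw [uIcc_of_le hτ.1] at hs
    have := h.integral_space hα hαβ hβ (hsubτ hs) z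
    simp only [mul_left_comm _ (Complex.exp (a * z ^ 2 * s)), intervalIntegral.integral_const_mul,
      this]
    ring
  have hαm : α ∈ Icc (0 : ℝ) 1 := ⟨hα, hαβ.trans hβ⟩
  have hβm : β ∈ Icc (0 : ℝ) 1 := ⟨hα.trans hαβ, hβ⟩
  have i : ∀ y ∈ Icc (0 : ℝ) 1, IntervalIntegrable (fun s => Complex.exp (-Complex.I * z * y) *
      (c a z 0 * (Complex.exp (a * z ^ 2 * s) * dx q 0 y s) +
        c a z 1 * (Complex.exp (a * z ^ 2 * s) * dx q 1 y s))) volume 0 τ := fun y hy =>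
    (((hint 0 zero_le_one y hy).const_mul _).add ((hint 1 le_rfl y hy).const_mul _)).const_mul _
  have e : ∀ y ∈ Icc (0 : ℝ) 1, ∫ s in (0 : ℝ)..τ, (Complex.exp (-Complex.I * z * y) *
      (c a z 0 * (Complex.exp (a * z ^ 2 * s) * dx q 0 y s) +
        c a z 1 * (Complex.exp (a * z ^ 2 * s) * dx q 1 y s))) =
      Complex.exp (-Complex.I * z * y) *
          (c a z 0 * (∫ s in (0 : ℝ)..τ, Complex.exp (a * z ^ 2 * s) * dx q 0 y s) +
            c a z 1 * ∫ s in (0 : ℝ)..τ, Complex.exp (a * z ^ 2 * s) * dx q 1 y s) := by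
    intro y hy
    rw [intervalIntegral.integral_const_mul, intervalIntegral.integral_add
      ((hint 0 zero_le_one y hy).const_mul _) ((hint 1 le_rfl y hy).const_mul _),
      intervalIntegral.integral_const_mul, intervalIntegral.integral_const_mul]
  rw [← hleft, hswap, hright, intervalIntegral.integral_sub (i β hβm) (i α hαm), e β hβm, e α hαm]

theorem vecMul_matA_zero (z : ℂ) (X : Fin (m + 1) × Fin 2 → ℂ) (k : Fin 2) :
    Matrix.vecMul X (matA η b z) (0, k) =
      ∑ r, (X (r, 0) * B η b 0 k r z + X (r, 1) * B η b 1 k r z) := by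
  simp only [Matrix.vecMul, dotProduct, Fintype.sum_prod_type, Fin.sum_univ_two, matA,
    Matrix.of_apply, Fin.cases_zero]

theorem vecMul_matA_succ (z : ℂ) (X : Fin (m + 1) × Fin 2 → ℂ) (l : Fin m) (p : Fin 2) :
    Matrix.vecMul X (matA η b z) (l.succ, p) = X (l.succ, p) - X (l.castSucc, p) := by
  have hne : l.castSucc ≠ l.succ := (Fin.castSucc_lt_succ).ne
  have h1 : ∀ r : Fin (m + 1), ∑ p' : Fin 2, X (r, p') * (if p' = p then
      (if r = l.succ then 1 else if r = l.castSucc then -1 else 0) else 0) =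
      (if r = l.succ then X (r, p) else 0) - (if r = l.castSucc then X (r, p) else 0) := by
    intro r
    simp only [mul_ite, mul_zero, Finset.sum_ite_eq', Finset.mem_univ, if_true]
    split_ifs with h2 h3
    · exact absurd (h3.symm.trans h2) hne
    all_goals simp
  simp only [Matrix.vecMul, dotProduct, Fintype.sum_prod_type, matA, Matrix.of_apply,
    Fin.cases_succ, h1, Finset.sum_sub_distrib, Finset.sum_ite_eq', Finset.mem_univ, if_true]

/-- The transformed multipoint conditions. They are written with `a∫` rather than `f` because these
integrals depend on `z²` only and so are the same at `z` and `-z`. -/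
theorem IsSolution.hData_eq (h : IsSolution a η b T q₀ g q) (hη : ∀ r, η r ∈ Icc (0 : ℝ) 1)
    {τ : ℝ} (hτ : τ ∈ Icc 0 T) (z : ℂ) (j : Fin 2) :
    hData a g τ z j = ∑ r, (b 0 j r * (a * ∫ s in (0 : ℝ)..τ,
        Complex.exp (a * z ^ 2 * s) * dx q 0 (η r) s) +
      b 1 j r * (a * ∫ s in (0 : ℝ)..τ, Complex.exp (a * z ^ 2 * s) * dx q 1 (η r) s)) := by
  have hexpt : Continuous fun s : ℝ => Complex.exp (a * z ^ 2 * s) := by fun_prop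
  have hsubτ : Icc 0 τ ⊆ Icc 0 T := Icc_subset_Icc_right hτ.2
  have hint : ∀ k ≤ 1, ∀ r, IntervalIntegrable
      (fun s => Complex.exp (a * z ^ 2 * s) * dx q k (η r) s) volume 0 τ := fun k hk r =>
    (hexpt.continuousOn.mul ((h.continuousOn_dx_right (hk.trans (by norm_num)) (hη r)).mono
      hsubτ)).intervalIntegrable_of_Icc hτ.1
  have h1 : ∫ s in (0 : ℝ)..τ, Complex.exp (a * z ^ 2 * s) * g j s =
      ∫ s in (0 : ℝ)..τ, ∑ r, (b 0 j r * (Complex.exp (a * z ^ 2 * s) * dx q 0 (η r) s) +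
        b 1 j r * (Complex.exp (a * z ^ 2 * s) * dx q 1 (η r) s)) := by
    refine intervalIntegral.integral_congr fun s hs => ?_
    rw [uIcc_of_le hτ.1] at hs
    simp only [← h.multipoint j s (hsubτ hs), Fin.sum_univ_two, ← Finset.sum_add_distrib,
      Finset.mul_sum]
    refine Finset.sum_congr rfl fun r _ => ?_
    simp only [Fin.val_zero, Fin.val_one]
    ring
  rw [hData, h1, intervalIntegral.integral_finsetSum fun r _ =>
    ((hint 0 zero_le_one r).const_mul _).add ((hint 1 le_rfl r).const_mul _), Complex.I_sq,
    neg_neg, div_one, Finset.mul_sum]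
  refine Finset.sum_congr rfl fun r _ => ?_
  rw [intervalIntegral.integral_add ((hint 0 zero_le_one r).const_mul _)
    ((hint 1 le_rfl r).const_mul _), intervalIntegral.integral_const_mul,
    intervalIntegral.integral_const_mul]
  ring

theorem E_mul_E_neg (η : Fin (m + 1) → ℝ) (r : Fin (m + 1)) (z : ℂ) :
    E η r z * E η r (-z) = 1 := by
  rw [E, E, ← Complex.exp_add]; simp

/-- The boundary transforms solve the system, and hence split into a part built from the data and a
part built from `q(·, τ)`. -/
theorem IsSolution.boundary_split (h : IsSolution a η b T q₀ g q) (hη : ∀ r, η r ∈ Icc (0 : ℝ) 1)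
    (hmono : Monotone η) {τ : ℝ} (hτ : τ ∈ Icc 0 T) {z : ℂ} (hz : z ≠ 0)
    (hΔ : Delta η b z ≠ 0) (r : Fin (m + 1)) :
    E η r z * (f a η q τ 0 r z + f a η q τ 1 r z) =
      xData a η b q₀ g τ r z + Complex.exp (a * z ^ 2 * τ) * xTau η b q τ r z := by
  -- Candidate solution: `x_r = E_r(z)(f_0^r + f_1^r)(z)` and `X_r = E_r(-z)(f_0^r + f_1^r)(-z)`.
  -- The right-hand side is the data vector plus `e^{az²τ}` times the vector of `q(·, τ)`.
  have hsol := (sysSol_eq_iff η b z hΔ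
    (rowVec (hData a g τ z) (fun l => -pieceHat η q₀ l z) (fun l => -pieceHat η q₀ l (-z)) +
      Complex.exp (a * z ^ 2 * τ) • rowVec 0 (fun l => pieceHat η (fun x => q x τ) l z)
        (fun l => pieceHat η (fun x => q x τ) l (-z)))
    (fun i => if i.2 = 0 then E η i.1 z * (f a η q τ 0 i.1 z + f a η q τ 1 i.1 z)
      else E η i.1 (-z) * (f a η q τ 0 i.1 (-z) + f a η q τ 1 i.1 (-z)))).2 ?_
  · have := congrFun hsol (r, 0)
    rw [sysSol, Matrix.add_vecMul, Matrix.smul_vecMul] at this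
    simpa [xData, xTau, sysSol] using this.symm
  · ext ⟨l, p⟩
    refine Fin.cases ?_ (fun l => ?_) l
    · rw [vecMul_matA_zero]
      simp only [Pi.add_apply, Pi.smul_apply, rowVec, Fin.cases_zero, Pi.zero_apply, smul_zero,
        add_zero, if_true, one_ne_zero, if_false, h.hData_eq hη hτ]
      refine Finset.sum_congr rfl fun r _ => ?_
      simp only [B, f, c, if_true, one_ne_zero, if_false, neg_sq, Fin.val_zero, Fin.val_one]
      -- As `E_r(z) E_r(-z) = 1` and `f_0^r` is odd while `f_1^r` is even in `z`, the cross terms of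
      -- `x_r B_{0k}^r + X_r B_{1k}^r` cancel, and the factor `iz` of `c₀` cancels `1/(iz)`.
      have hE := E_mul_E_neg η r z
      set e := E η r z
      set e' := E η r (-z)
      generalize (∫ s in (0 : ℝ)..τ, Complex.exp (a * z ^ 2 * s) * dx q 0 (η r) s) = u
      generalize (∫ s in (0 : ℝ)..τ, Complex.exp (a * z ^ 2 * s) * dx q 1 (η r) s) = v
      have hI : Complex.I * z * (1 / (Complex.I * z)) = 1 := by
        field_simp
      linear_combination (a * b 0 p r * u * (Complex.I * z * (1 / (Complex.I * z))) +
        a * b 1 p r * v) * hE + a * b 0 p r * u * hI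
    · rw [vecMul_matA_succ]
      have hrel := h.global_relation (hη l.castSucc).1 (hmono (Fin.castSucc_lt_succ).le)
        (hη l.succ).2 hτ
      by_cases hp : p = 0
      · simp only [hp, Pi.add_apply, Pi.smul_apply, rowVec, Fin.cases_succ, if_true, smul_eq_mul]
        have := hrel z
        simp only [pieceHat, E, f, Fin.val_zero, Fin.val_one]
        linear_combination -this
      · simp only [hp, Pi.add_apply, Pi.smul_apply, rowVec, Fin.cases_succ, if_false, smul_eq_mul]
        -- The columns for `X` carry the global relation at `-z`, with the same factor `e^{az²τ}`.
        have := hrel (-z)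
        simp only [pieceHat, E, f, Fin.val_zero, Fin.val_one]
        rw [neg_sq] at this ⊢
        linear_combination -this

end

/-! ### Holomorphy and growth of the transforms -/

/-- A general parameter `w` serves both the transforms in space, `w = -iz`, and those in time, `w =
az²`. -/
theorem differentiable_integral_exp_mul {α β : ℝ} {u : ℝ → ℂ}
    (hu : IntervalIntegrable u volume α β) :
    Differentiable ℂ fun w : ℂ => ∫ x in α..β, Complex.exp (w * x) * u x := by
  intro w₀
  have hexp : ∀ w : ℂ, Continuous fun x : ℝ => Complex.exp (w * x) := fun w => by fun_prop
  -- On the unit ball around `w₀` the derivative of the integrand is dominated by `K e^{(‖w₀‖ + 1)K}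
  -- ‖u x‖`.
  set K := max |α| |β|
  have hint : ∀ w : ℂ, IntervalIntegrable (fun x => Complex.exp (w * x) * u x) volume α β :=
    fun w => hu.continuousOn_mul (hexp w).continuousOn
  have hint' : IntervalIntegrable (fun x => x * (Complex.exp (w₀ * x) * u x)) volume α β :=
    (hint w₀).continuousOn_mul Complex.continuous_ofReal.continuousOn
  refine (intervalIntegral.hasDerivAt_integral_of_dominated_loc_of_deriv_le
    (F' := fun w x => x * (Complex.exp (w * x) * u x))
    (bound := fun x => K * (Real.exp ((‖w₀‖ + 1) * K) * ‖u x‖))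
    (Metric.ball_mem_nhds w₀ one_pos) (Eventually.of_forall fun w =>
      (intervalIntegrable_iff.1 (hint w)).aestronglyMeasurable)
    (hint w₀) (intervalIntegrable_iff.1 hint').aestronglyMeasurable (ae_of_all _ fun x hx w hw => ?_)
    ((hu.norm.const_mul _).const_mul _) (ae_of_all _ fun x _ w _ => ?_)).2.differentiableAt
  · have hxK : |x| ≤ K := by
      have := uIoc_subset_uIcc hx
      rw [mem_uIcc] at this
      rcases this with h | h
      · exact abs_le_max_abs_abs h.1 h.2
      · rw [show K = max |β| |α| from max_comm _ _]
        exact abs_le_max_abs_abs h.1 h.2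
    have hwK : ‖w‖ ≤ ‖w₀‖ + 1 := by
      have := norm_le_norm_add_norm_sub' w w₀
      rw [mem_ball_iff_norm] at hw
      linarith
    have h1 : ‖Complex.exp (w * x)‖ ≤ Real.exp ((‖w₀‖ + 1) * K) := by
      refine (Complex.norm_exp_le_exp_norm _).trans (Real.exp_le_exp.2 ?_)
      rw [norm_mul, Complex.norm_real, Real.norm_eq_abs]
      gcongr
    rw [norm_mul, norm_mul, Complex.norm_real, Real.norm_eq_abs]
    gcongr
  · have h1 : HasDerivAt (fun w : ℂ => w * (x : ℂ)) (x : ℂ) w := by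
      simpa using (hasDerivAt_id w).mul_const (x : ℂ)
    refine (h1.cexp.mul_const (u x)).congr_deriv ?_
    ring

theorem differentiableAt_det {n : Type*} [Fintype n] [DecidableEq n] {M : ℂ → Matrix n n ℂ}
    {z : ℂ} (hM : ∀ i j, DifferentiableAt ℂ (fun w => M w i j) z) :
    DifferentiableAt ℂ (fun w => (M w).det) z := by
  simp only [Matrix.det_apply]
  exact DifferentiableAt.fun_sum fun σ _ =>
    (DifferentiableAt.fun_finsetProd fun i _ => hM _ _).const_smul _

/-- Cramer's rule: the entries of the inverse are quotients of determinants. -/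
theorem differentiableAt_inv_apply {n : Type*} [Fintype n] [DecidableEq n] {M : ℂ → Matrix n n ℂ}
    {z : ℂ} (hM : ∀ i j, DifferentiableAt ℂ (fun w => M w i j) z) (hz : (M z).det ≠ 0) (i j : n) :
    DifferentiableAt ℂ (fun w => (M w)⁻¹ i j) z := by
  simp only [Matrix.inv_def, Matrix.smul_apply, Ring.inverse_eq_inv', smul_eq_mul,
    Matrix.adjugate_apply]
  refine ((differentiableAt_det hM).inv hz).mul (differentiableAt_det fun k l => ?_)
  simp only [Matrix.updateRow_apply]
  split_ifs
  · exact differentiableAt_const _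
  · exact hM _ _

section

variable {m : ℕ} {a : ℂ} {η : Fin (m + 1) → ℝ} {b : Fin 2 → Fin 2 → Fin (m + 1) → ℂ}
  {T : ℝ} {q₀ : ℝ → ℂ} {g : Fin 2 → ℝ → ℂ} {q : ℝ → ℝ → ℂ}

theorem differentiable_pieceHat {u : ℝ → ℂ} {l : Fin m}
    (hu : IntervalIntegrable u volume (η l.castSucc) (η l.succ)) :
    Differentiable ℂ (pieceHat η u l) :=
  (differentiable_integral_exp_mul hu).comp (by fun_prop : Differentiable ℂ fun z => -Complex.I * z)

theorem differentiableAt_matA {z : ℂ} (hz : z ≠ 0) (i j : Fin (m + 1) × Fin 2) :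
    DifferentiableAt ℂ (fun w => matA η b w i j) z := by
  obtain ⟨l, k⟩ := j
  refine Fin.cases ?_ (fun r => ?_) l
  · simp only [matA, Matrix.of_apply, Fin.cases_zero, B, E]
    have h1 : DifferentiableAt ℂ (fun w : ℂ => 1 / (Complex.I * w)) z :=
      (differentiableAt_const _).div (by fun_prop) (mul_ne_zero Complex.I_ne_zero hz)
    split_ifs <;> fun_prop
  · simp only [matA, Matrix.of_apply, Fin.cases_succ]
    exact differentiableAt_const _

theorem differentiableAt_xTau {τ : ℝ} {z : ℂ} (hq : ∀ l : Fin m,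
      IntervalIntegrable (fun x => q x τ) volume (η l.castSucc) (η l.succ))
    (hz : z ≠ 0) (hΔ : Delta η b z ≠ 0) (r : Fin (m + 1)) :
    DifferentiableAt ℂ (xTau η b q τ r) z := by
  unfold xTau sysSol
  simp only [Matrix.vecMul, dotProduct]
  refine DifferentiableAt.fun_sum fun i _ => DifferentiableAt.fun_mul ?_
    (differentiableAt_inv_apply (differentiableAt_matA hz) hΔ _ _)
  obtain ⟨l, k⟩ := i
  refine Fin.cases ?_ (fun l => ?_) l
  · exact differentiableAt_const _
  · simp only [rowVec, Fin.cases_succ]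
    split_ifs
    · exact differentiable_pieceHat (hq l) z
    · exact ((differentiable_pieceHat (hq l)).comp differentiable_neg) z

theorem IsSolution.differentiable_f (h : IsSolution a η b T q₀ g q) {r : Fin (m + 1)}
    (hη : η r ∈ Icc (0 : ℝ) 1) {τ : ℝ} (hτ : τ ∈ Icc 0 T) (k : Fin 2) :
    Differentiable ℂ (f a η q τ k r) := by
  have hk : (k : ℕ) ≤ 2 := k.2.le
  have hq : IntervalIntegrable (fun s => dx q k (η r) s) volume 0 τ :=
    ((h.continuousOn_dx_right hk hη).mono (Icc_subset_Icc_right hτ.2)).intervalIntegrable_of_Icc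
      hτ.1
  have hc : Differentiable ℂ fun z => c a z k := by
    unfold c
    split_ifs <;> fun_prop
  exact hc.mul ((differentiable_integral_exp_mul hq).comp
    (by fun_prop : Differentiable ℂ fun z => a * z ^ 2))

/-- Here `|e^{az²s}| ≤ 1`, so the time integral is bounded uniformly in `z`, and `c_k` grows at most
linearly. -/
theorem IsSolution.exists_norm_f_le (h : IsSolution a η b T q₀ g q) {r : Fin (m + 1)}
    (hη : η r ∈ Icc (0 : ℝ) 1) {τ : ℝ} (hτ : τ ∈ Icc 0 T) (k : Fin 2) :
    ∃ C, ∀ z : ℂ, (a * z ^ 2).re ≤ 0 → ‖f a η q τ k r z‖ ≤ C * (‖z‖ + 1) := by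
  have hk : (k : ℕ) ≤ 2 := k.2.le
  obtain ⟨C, hC⟩ := isCompact_Icc.exists_bound_of_continuousOn
    ((h.continuousOn_dx_right hk hη).mono (Icc_subset_Icc_right hτ.2))
  refine ⟨‖a‖ * (C * |τ - 0|), fun z hz => ?_⟩
  have h1 : ‖∫ s in (0 : ℝ)..τ, Complex.exp (a * z ^ 2 * s) * dx q k (η r) s‖ ≤ C * |τ - 0| := by
    refine intervalIntegral.norm_integral_le_of_norm_le_const fun s hs => ?_
    rw [uIoc_of_le hτ.1] at hs
    have h2 : ‖Complex.exp (a * z ^ 2 * s)‖ ≤ 1 := by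
      rw [Complex.norm_exp, Real.exp_le_one_iff, Complex.re_mul_ofReal]
      exact mul_nonpos_of_nonpos_of_nonneg hz hs.1.le
    rw [norm_mul, ← one_mul C]
    exact mul_le_mul h2 (hC s ⟨hs.1.le, hs.2⟩) (norm_nonneg _) zero_le_one
  have h2 : ‖c a z k‖ ≤ ‖a‖ * (‖z‖ + 1) := by
    unfold c
    split_ifs
    · rw [norm_mul, norm_mul, Complex.norm_I, one_mul]
      nlinarith [norm_nonneg a]
    · nlinarith [norm_nonneg a, mul_nonneg (norm_nonneg a) (norm_nonneg z)]
  rw [f, norm_mul]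
  calc ‖c a z k‖ * _ ≤ (‖a‖ * (‖z‖ + 1)) * (C * |τ - 0|) :=
        mul_le_mul h2 h1 (norm_nonneg _) (by positivity)
    _ = _ := by ring

/-! ### The contribution of one contour, and the conclusion -/

/-- Half of the decay rate absorbs the linear factor: `y + 1 ≤ (2/k + 1)(ky/2 + 1) ≤ (2/k + 1)
e^{ky/2}`. -/
theorem add_one_mul_exp_neg_le {k y : ℝ} (hk : 0 < k) (hy : 0 ≤ y) :
    (y + 1) * Real.exp (-k * y) ≤ (2 / k + 1) * Real.exp (-(k / 2) * y) := by
  have h1 : Real.exp (-k * y) = Real.exp (-(k / 2) * y) * Real.exp (-(k / 2 * y)) := by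
    rw [← Real.exp_add]; ring_nf
  have h2 : (y + 1) * Real.exp (-(k / 2 * y)) ≤ 2 / k + 1 := by
    have h3 := Real.add_one_le_exp (k / 2 * y)
    rw [Real.exp_neg, ← div_eq_mul_inv, div_le_iff₀ (Real.exp_pos _)]
    calc y + 1 ≤ (2 / k + 1) * (k / 2 * y + 1) := by
          have : (2 / k + 1) * (k / 2 * y + 1) = y + 1 + (2 / k + k / 2 * y) := by field_simp; ring
          rw [this]
          have : 0 ≤ 2 / k + k / 2 * y := by positivity
          linarith
      _ ≤ _ := by gcongr
  rw [h1]
  nlinarith [Real.exp_pos (-(k / 2) * y)]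

/-- The contribution of one of the two contours, for a sector in which the phase `e^{izx} E_r`
decays exponentially. -/
theorem IsSolution.sector_contribution (h : IsSolution a η b T q₀ g q)
    (hη : ∀ r, η r ∈ Icc (0 : ℝ) 1) (hmono : Monotone η) {t τ : ℝ} (ht : 0 ≤ t) (htτ : t ≤ τ)
    (hτ : τ ≤ T) {φ₁ φ₂ R : ℝ} (hR : 0 < R) (hφ : φ₁ ≤ φ₂) {S : Set ℂ}
    (hS : ∀ r, R ≤ r → ∀ φ ∈ Icc φ₁ φ₂, polar r φ ∈ S)
    (hS' : ∀ z ∈ S, z ≠ 0 ∧ (a * z ^ 2).re ≤ 0 ∧ Delta η b z ≠ 0)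
    (hφ₁ : ∀ r, (a * polar r φ₁ ^ 2).re = 0) (hφ₂ : ∀ r, (a * polar r φ₂ ^ 2).re = 0)
    {r : Fin (m + 1)} {x k : ℝ} (hk : 0 < k)
    (hdecay : ∀ z ∈ S, ‖Complex.exp (Complex.I * z * x)‖ * ‖E η r z‖ ≤ Real.exp (-k * ‖z‖))
    (hO : xTau η b q τ r =O[cobounded ℂ ⊓ 𝓟 S] fun z => E η r z * z⁻¹) :
    (SectorIntegrable φ₁ φ₂ R (fun z =>
        Complex.exp (Complex.I * z * x + a * z ^ 2 * (τ - t)) * xTau η b q τ r z) ∧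
      0 = sectorIntegral φ₁ φ₂ R (fun z =>
        Complex.exp (Complex.I * z * x + a * z ^ 2 * (τ - t)) * xTau η b q τ r z)) ∧
    SectorIntegrable φ₁ φ₂ R (fun z => kern a x t z * xData a η b q₀ g τ r z) ∧
    sectorIntegral φ₁ φ₂ R
        (fun z => kern a x t z * (E η r z * (f a η q τ 0 r z + f a η q τ 1 r z))) =
      sectorIntegral φ₁ φ₂ R (fun z => kern a x t z * xData a η b q₀ g τ r z) := by
  have hτT : τ ∈ Icc 0 T := ⟨ht.trans htτ, hτ⟩
  have hqint : ∀ l : Fin m,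
      IntervalIntegrable (fun x => q x τ) volume (η l.castSucc) (η l.succ) := fun l =>
    ((h.contDiffOn τ hτT).continuousOn.mono
      (Icc_subset_Icc (hη _).1 (hη _).2)).intervalIntegrable_of_Icc
        (hmono (Fin.castSucc_lt_succ).le)
  set F : ℂ → ℂ := fun z =>
    Complex.exp (Complex.I * z * x + a * z ^ 2 * (τ - t)) * xTau η b q τ r z with hFdef
  set G : ℂ → ℂ := fun z =>
    kern a x t z * (E η r z * (f a η q τ 0 r z + f a η q τ 1 r z)) with hGdef
  have hFd : ∀ z ∈ S, DifferentiableAt ℂ F z := fun z hz =>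
    DifferentiableAt.mul (by fun_prop) (differentiableAt_xTau hqint (hS' z hz).1 (hS' z hz).2.2 r)
  have hFO : F =O[cobounded ℂ ⊓ 𝓟 S] fun z => Real.exp (-k * ‖z‖) := by
    -- The factor `z⁻¹` is only used as a bounded one; the decay comes from the phase `e^{izx} E_r`.
    have hinv : (fun z : ℂ => z⁻¹) =O[cobounded ℂ ⊓ 𝓟 S] fun _ => (1 : ℂ) :=
      (tendsto_inv₀_cobounded (α := ℂ)).isBigO_one ℂ |>.mono inf_le_left
    have h1 := (isBigO_refl (fun z : ℂ =>
      Complex.exp (Complex.I * z * x + a * z ^ 2 * (τ - t))) (cobounded ℂ ⊓ 𝓟 S)).mul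
        (hO.trans ((isBigO_refl (fun z => E η r z) _).mul hinv))
    refine h1.trans (IsBigO.of_bound 1 ?_)
    filter_upwards [mem_inf_of_right (mem_principal_self S)] with z hz
    rw [mul_one, one_mul, Real.norm_of_nonneg (Real.exp_pos _).le, norm_mul, Complex.exp_add,
      norm_mul]
    have h2 : ‖Complex.exp (a * z ^ 2 * (τ - t))‖ ≤ 1 := by
      rw [Complex.norm_exp, Real.exp_le_one_iff, ← Complex.ofReal_sub, Complex.re_mul_ofReal]
      exact mul_nonpos_of_nonpos_of_nonneg (hS' z hz).2.1 (sub_nonneg.2 htτ)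
    calc _ ≤ ‖Complex.exp (Complex.I * z * x)‖ * 1 * ‖E η r z‖ := by gcongr
      _ ≤ _ := by rw [mul_one]; exact hdecay z hz
  have hGc : Continuous G := by
    have h0 := (h.differentiable_f (hη r) hτT 0).continuous
    have h1 := (h.differentiable_f (hη r) hτT 1).continuous
    unfold G kern E
    fun_prop
  obtain ⟨C₀, hC₀⟩ := h.exists_norm_f_le (hη r) hτT 0
  obtain ⟨C₁, hC₁⟩ := h.exists_norm_f_le (hη r) hτT 1
  -- Inside the sector `e^{-az²t}` is unbounded, but on the two rays `Re (az²) = 0` and it has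
  -- modulus one. So `G` is linear growth times exponential decay there, and on the arc continuity
  -- suffices.
  have hray : ∀ φ ∈ Icc φ₁ φ₂, (∀ r, (a * polar r φ ^ 2).re = 0) →
      IntegrableOn (fun r : ℝ => G (polar r φ)) (Ioi R) := by
    intro φ hφ' hre
    refine integrableOn_ray (S := {z | z ∈ S ∧ (a * z ^ 2).re = 0})
      (fun r hr => ⟨hS r hr φ hφ', hre r⟩) (fun z _ => hGc.continuousAt) (half_pos hk) ?_
    refine IsBigO.of_bound ((|C₀| + |C₁|) * (2 / k + 1)) ?_
    filter_upwards [mem_inf_of_right (mem_principal_self _)] with z hz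
    obtain ⟨hzS, hz0⟩ : z ∈ S ∧ (a * z ^ 2).re = 0 := hz
    have e1 : ‖kern a x t z‖ = ‖Complex.exp (Complex.I * z * x)‖ := by
      rw [kern, Complex.norm_exp, Complex.norm_exp, Complex.sub_re,
        Complex.re_mul_ofReal (a * z ^ 2), hz0,
        zero_mul, sub_zero]
    have e2 : ‖f a η q τ 0 r z + f a η q τ 1 r z‖ ≤ (|C₀| + |C₁|) * (‖z‖ + 1) := by
      refine (norm_add_le _ _).trans ?_
      rw [add_mul]
      have hp : 0 ≤ ‖z‖ + 1 := by positivity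
      exact add_le_add
        ((hC₀ z hz0.le).trans (mul_le_mul_of_nonneg_right (le_abs_self _) hp))
        ((hC₁ z hz0.le).trans (mul_le_mul_of_nonneg_right (le_abs_self _) hp))
    have e3 := add_one_mul_exp_neg_le hk (norm_nonneg z)
    rw [Real.norm_of_nonneg (Real.exp_pos _).le]
    calc ‖G z‖ = (‖Complex.exp (Complex.I * z * x)‖ * ‖E η r z‖) *
          ‖f a η q τ 0 r z + f a η q τ 1 r z‖ := by
          simp only [hGdef, norm_mul, e1, mul_assoc]
      _ ≤ Real.exp (-k * ‖z‖) * ((|C₀| + |C₁|) * (‖z‖ + 1)) :=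
          mul_le_mul (hdecay z hzS) e2 (norm_nonneg _) (Real.exp_pos _).le
      _ = (|C₀| + |C₁|) * ((‖z‖ + 1) * Real.exp (-k * ‖z‖)) := by ring
      _ ≤ (|C₀| + |C₁|) * ((2 / k + 1) * Real.exp (-(k / 2) * ‖z‖)) := by gcongr
      _ = _ := by ring
  have hGint : SectorIntegrable φ₁ φ₂ R G :=
    ⟨hray φ₂ ⟨hφ, le_rfl⟩ hφ₂,
      ((continuousOn_arc fun _ _ => hGc.continuousAt).intervalIntegrable_of_Icc hφ).symm,
      hray φ₁ ⟨le_rfl, hφ⟩ hφ₁⟩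
  have hFint := sectorIntegrable_of_exp_decay hφ hS (fun z hz => (hFd z hz).continuousAt) hk hFO
  have hF0 := sectorIntegral_eq_zero hR hφ hS hFd hk hFO
  -- `G` contains the boundary transforms and `F` the part from `q(·, τ)`; by `boundary_split` their
  -- difference is the data integrand, which inherits integrability and the value of the integral of
  -- `G`.
  have hGF : ∀ z ∈ S, G z - F z = kern a x t z * xData a η b q₀ g τ r z := by
    intro z hz
    have h1 := h.boundary_split hη hmono hτT (hS' z hz).1 (hS' z hz).2.2 r
    have h2 : Complex.exp (Complex.I * z * x + a * z ^ 2 * (τ - t)) =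
        kern a x t z * Complex.exp (a * z ^ 2 * τ) := by
      rw [kern, ← Complex.exp_add]; ring_nf
    simp only [hGdef, hFdef, h1, h2]
    ring
  have hcongr : ∀ s, R ≤ s → ∀ φ ∈ Icc φ₁ φ₂, G (polar s φ) - F (polar s φ) =
      kern a x t (polar s φ) * xData a η b q₀ g τ r (polar s φ) := fun s hs φ hφ' =>
    hGF _ (hS s hs φ hφ')
  refine ⟨⟨hFint, hF0.symm⟩, (hGint.sub hFint).congr hφ hcongr, ?_⟩
  rw [← sectorIntegral_congr (F := fun z => G z - F z)
    (G := fun z => kern a x t z * xData a η b q₀ g τ r z) hφ hcongr, sectorIntegral_sub hGint hFint, hF0, sub_zero]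

end

/-- For `0 < x < 1` the exponent is negative for `η_r = 0` in the upper half plane and for `η_r = 1`
in the lower one. This decides which component is used on which contour. -/
theorem norm_exp_I_mul_E {m : ℕ} (η : Fin (m + 1) → ℝ) (r : Fin (m + 1)) (x : ℝ) (z : ℂ) :
    ‖Complex.exp (Complex.I * z * x)‖ * ‖E η r z‖ = Real.exp ((η r - x) * z.im) := by
  rw [E, Complex.norm_exp, Complex.norm_exp, ← Real.exp_add]
  congr 1
  simp
  ring

theorem re_mul_polar_angle_sq (a : ℂ) (r : ℝ) :
    (a * polar r (angle a) ^ 2).re = 0 ∧ (a * polar r (angle a + Real.pi / 2) ^ 2).re = 0 := by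
  rw [re_mul_polar_sq, re_mul_polar_sq]
  have h1 : a.arg + 2 * angle a = Real.pi / 2 := by unfold angle; ring
  have h2 : a.arg + 2 * (angle a + Real.pi / 2) = Real.pi / 2 + Real.pi := by
    unfold angle; ring
  rw [h1, h2, Real.cos_add_pi, Real.cos_pi_div_two]
  simp

end

end Multipoint

theorem proposition5p3 (m : ℕ) (a : ℂ) (ha : 0 < a.re)
    (η : Fin (m + 1) → ℝ) (hη : StrictMono η) (hη0 : η 0 = 0) (hηm : η (Fin.last m) = 1)
    (b : Fin 2 → Fin 2 → Fin (m + 1) → ℂ)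
    (hΔ : ∃ z : ℂ, z ≠ 0 ∧ Multipoint.Delta η b z ≠ 0) :
    ∃ R₀ : ℝ, 0 < R₀ ∧ ∀ R : ℝ, R₀ ≤ R →
      ∀ (T : ℝ) (q₀ : ℝ → ℂ) (g : Fin 2 → ℝ → ℂ) (q : ℝ → ℝ → ℂ),
      Multipoint.IsSolution a η b T q₀ g q →
      ∀ t ∈ Set.Ioo 0 T, ∀ τ ∈ Set.Icc t T,
      Multipoint.xTau η b q τ 0
        =O[Bornology.cobounded ℂ ⊓ Filter.principal (closure (Multipoint.Dplus a R))]
          (fun z => z⁻¹) →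
      Multipoint.xTau η b q τ (Fin.last m)
        =O[Bornology.cobounded ℂ ⊓ Filter.principal (closure (Multipoint.Dminus a R))]
          (fun z => Multipoint.E η (Fin.last m) z * z⁻¹) →
      ∀ x ∈ Set.Ioo (0 : ℝ) 1,
        -- the two contour integrals converge absolutely and vanish
        (Multipoint.IntegrablePlus a R (fun z =>
            Complex.exp (Complex.I * z * x + a * z ^ 2 * (τ - t)) * Multipoint.xTau η b q τ 0 z) ∧
          0 = Multipoint.intPlus a R (fun z =>
            Complex.exp (Complex.I * z * x + a * z ^ 2 * (τ - t)) *
              Multipoint.xTau η b q τ 0 z)) ∧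
        (Multipoint.IntegrableMinus a R (fun z =>
            Complex.exp (Complex.I * z * x + a * z ^ 2 * (τ - t)) *
              Multipoint.xTau η b q τ (Fin.last m) z) ∧
          0 = Multipoint.intMinus a R (fun z =>
            Complex.exp (Complex.I * z * x + a * z ^ 2 * (τ - t)) *
              Multipoint.xTau η b q τ (Fin.last m) z)) ∧
        -- the boundary transforms split into a part built from the data and a part with `q̂_τ`
        (∀ z ∈ frontier (Multipoint.Dplus a R),
          Multipoint.f a η q τ 0 0 z + Multipoint.f a η q τ 1 0 z =
            Multipoint.xData a η b q₀ g τ 0 z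
              + Complex.exp (a * z ^ 2 * τ) * Multipoint.xTau η b q τ 0 z) ∧
        (∀ z ∈ frontier (Multipoint.Dminus a R),
          Multipoint.E η (Fin.last m) z *
              (Multipoint.f a η q τ 0 (Fin.last m) z + Multipoint.f a η q τ 1 (Fin.last m) z) =
            Multipoint.xData a η b q₀ g τ (Fin.last m) z
              + Complex.exp (a * z ^ 2 * τ) * Multipoint.xTau η b q τ (Fin.last m) z) ∧
        -- dropping the part with `q̂_τ` does not change the solution representation
        Multipoint.IntegrablePlus a R (fun z =>
          Multipoint.kern a x t z * Multipoint.xData a η b q₀ g τ 0 z) ∧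
        Multipoint.IntegrableMinus a R (fun z =>
          Multipoint.kern a x t z * Multipoint.xData a η b q₀ g τ (Fin.last m) z) ∧
        Multipoint.representation a q₀ R x t
            (fun z => Multipoint.f a η q τ 0 0 z + Multipoint.f a η q τ 1 0 z)
            (fun z => Multipoint.E η (Fin.last m) z *
              (Multipoint.f a η q τ 0 (Fin.last m) z + Multipoint.f a η q τ 1 (Fin.last m) z)) =
          Multipoint.representation a q₀ R x t
            (Multipoint.xData a η b q₀ g τ 0) (Multipoint.xData a η b q₀ g τ (Fin.last m)) := by
  obtain ⟨R₀, hR₀, hΔne⟩ := Multipoint.exists_Delta_ne_zero ha hΔ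
  obtain ⟨c, hc, hcz⟩ := Multipoint.exists_mul_norm_le_abs_im ha
  refine ⟨R₀, hR₀, fun R hR T q₀ g q h t ht τ hτ hO₀ hOm x hx => ?_⟩
  have hR0 : 0 < R := hR₀.trans_le hR
  have hη' : ∀ r, η r ∈ Icc (0 : ℝ) 1 := fun r =>
    ⟨hη0 ▸ hη.monotone (Fin.zero_le r), hηm ▸ hη.monotone (Fin.le_last r)⟩
  have hE0 : ∀ z, Multipoint.E η 0 z = 1 := fun z => by simp [Multipoint.E, hη0]
  have hpi := Real.pi_pos
  have hP := Multipoint.closure_Dplus_subset ha hR0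
  have hM := Multipoint.closure_Dminus_subset ha hR0
  have hP' : ∀ z ∈ closure (Multipoint.Dplus a R),
      z ≠ 0 ∧ (a * z ^ 2).re ≤ 0 ∧ Multipoint.Delta η b z ≠ 0 := fun z hz =>
    ⟨norm_pos_iff.1 (hR0.trans_le (hP hz).1), (hP hz).2.1,
      hΔne z (hR.trans (hP hz).1) (hP hz).2.1⟩
  have hM' : ∀ z ∈ closure (Multipoint.Dminus a R),
      z ≠ 0 ∧ (a * z ^ 2).re ≤ 0 ∧ Multipoint.Delta η b z ≠ 0 := fun z hz =>
    ⟨norm_pos_iff.1 (hR0.trans_le (hM hz).1), (hM hz).2.1,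
      hΔne z (hR.trans (hM hz).1) (hM hz).2.1⟩
  have hτT : τ ∈ Icc 0 T := ⟨ht.1.le.trans hτ.1, hτ.2⟩
  have hneg : ∀ r φ, (a * Multipoint.polar r (φ + Real.pi) ^ 2).re =
      (a * Multipoint.polar r φ ^ 2).re := fun r φ => by
    rw [Multipoint.polar_add_pi, neg_sq]
  -- Upper contour: the phase has modulus `e^{-x Im z}` and `Im z ≥ c‖z‖`, so the rate is `xc`.
  obtain ⟨p1, p2, p3⟩ := h.sector_contribution hη' hη.monotone ht.1.le hτ.1 hτ.2 hR0
    (φ₁ := Multipoint.angle a) (φ₂ := Multipoint.angle a + Real.pi / 2) (by linarith)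
    (S := closure (Multipoint.Dplus a R)) (r := 0) (x := x) (k := x * c)
    (Multipoint.polar_mem_closure (by linarith) fun r hr φ hφ =>
      Multipoint.polar_mem_Dplus ha hR0 hr hφ) hP'
    (fun r => (Multipoint.re_mul_polar_angle_sq a r).1)
    (fun r => (Multipoint.re_mul_polar_angle_sq a r).2) (mul_pos hx.1 hc)
    (fun z hz => by
      rw [Multipoint.norm_exp_I_mul_E, Real.exp_le_exp, hη0]
      have := hcz z (hP hz).2.1
      rw [abs_of_pos (hP hz).2.2] at this
      nlinarith [hx.1])
    (by simpa only [hE0, one_mul] using hO₀)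
  -- Lower contour: the phase has modulus `e^{(1-x) Im z}` and `Im z ≤ -c‖z‖`, so the rate is
  -- `(1-x)c`.
  obtain ⟨m1, m2, m3⟩ := h.sector_contribution hη' hη.monotone ht.1.le hτ.1 hτ.2 hR0
    (φ₁ := Multipoint.angle a + Real.pi) (φ₂ := Multipoint.angle a + Real.pi / 2 + Real.pi)
    (by linarith)
    (S := closure (Multipoint.Dminus a R)) (r := Fin.last m) (x := x) (k := (1 - x) * c)
    (Multipoint.polar_mem_closure (by linarith) fun r hr φ hφ =>
      Multipoint.polar_mem_Dminus ha hR0 hr hφ) hM'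
    (fun r => by rw [hneg]; exact (Multipoint.re_mul_polar_angle_sq a r).1)
    (fun r => by rw [hneg]; exact (Multipoint.re_mul_polar_angle_sq a r).2)
    (mul_pos (sub_pos.2 hx.2) hc)
    (fun z hz => by
      rw [Multipoint.norm_exp_I_mul_E, Real.exp_le_exp, hηm]
      have := hcz z (hM hz).2.1
      rw [abs_of_neg (hM hz).2.2] at this
      nlinarith [sub_pos.2 hx.2])
    hOm
  refine ⟨p1, m1, fun z hz => ?_, fun z hz => ?_, p2, m2, ?_⟩
  · have hz' := hP' z (frontier_subset_closure hz)
    rw [← h.boundary_split hη' hη.monotone hτT hz'.1 hz'.2.2 0, hE0, one_mul]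
  · have hz' := hM' z (frontier_subset_closure hz)
    exact h.boundary_split hη' hη.monotone hτT hz'.1 hz'.2.2 (Fin.last m)
  · simp only [hE0, one_mul] at p3
    unfold Multipoint.representation Multipoint.intPlus Multipoint.intMinus
    rw [p3, m3]
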